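/- Let $X_1, X_2, \dots$ be i.i.d. real random variables whose common law has a density with respect to Lebesgue measure and has finite variance. For $n\ge 1$ put $U_n = \frac{1}{\sqrt n}(X_1+\cdots+X_n)$. For a real random variable $Y$ with Lebesgue density $f_Y$, let $h(Y) = -\mathbb{E}[\log f_Y(Y)]$ denote its differential entropy. Then, for every $n\ge 1$, $U_n$ has a density and $h(U_n)$ is well defined as an element of $[-\infty,\infty)$ (the positive part of $-\log f_{U_n}(U_n)$ has finite expectation), and $$h(U_m)\le h(U_n)\qquad\text{for all } 1\le m\le n.$$ -/

import Mathlib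

open MeasureTheory ProbabilityTheory

namespace EntropyMonotonicity

noncomputable section

/-- The log-likelihood `log f(X)`, where `f` is the Lebesgue density of the law of `X`. -/
def logDensity {Ω : Type*} [MeasurableSpace Ω] (P : Measure Ω) (X : Ω → ℝ) (ω : Ω) : ℝ :=
  Real.log (pdf X P volume (X ω)).toReal

/-- The differential entropy `h(X) = -𝔼[log f(X)]`, as an extended real number: the expectation of
the positive part of `-log f(X)` minus the expectation of its negative part. -/
def entropy {Ω : Type*} [MeasurableSpace Ω] (P : Measure Ω) (X : Ω → ℝ) : EReal :=
  ((∫⁻ ω, ENNReal.ofReal (-logDensity P X ω) ∂P : ENNReal) : EReal)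
    - ((∫⁻ ω, ENNReal.ofReal (logDensity P X ω) ∂P : ENNReal) : EReal)

/-- `h(X)` is well defined as an element of `[-∞, ∞)`: the variable `X` has a Lebesgue density `f`,
and the positive part of `-log f(X)` has finite expectation. -/
def HasEntropy {Ω : Type*} [MeasurableSpace Ω] (P : Measure Ω) (X : Ω → ℝ) : Prop :=
  HasPDF X P volume ∧ ∫⁻ ω, ENNReal.ofReal (-logDensity P X ω) ∂P < ⊤

/-- The standardized sum `U_n = (X_1 + ⋯ + X_n) / √n`; the sequence is indexed from `0` here. -/
def standardizedSum {Ω : Type*} (X : ℕ → Ω → ℝ) (n : ℕ) (ω : Ω) : ℝ :=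
  (∑ i ∈ Finset.range n, X i ω) / √(n : ℝ)

end

end EntropyMonotonicity

namespace EntropyMonotonicity

open Real Filter Set Topology

/-! Smooth every law by a Gaussian of variance `t`. The density `heat σ t` is then smooth and
positive, its Fisher information `fisher σ t` is finite, and by de Bruijn's identity
(`hasDerivAt_heatEntropy`) entropy grows along the flow at half that rate. As `t → ∞`, the smoothed
entropies of two laws with finite second moment differ by `O(1/t)`. So of two laws, the one with
smaller Fisher information at all times has the larger smoothed entropy
(`heatEntropy_le_of_fisher_le`). It remains to compare Fisher informations of standardized sums and
to let `t → 0`.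

For the Fisher informations, let `ρ` be the score of a sum of `n + 1` smoothed i.i.d. variables, and
average `ρ` over one of them. Paired with the score of the `n`-fold sum, this average gives exactly
the Fisher information of the `(n + 1)`-fold sum (`integral_translateAverage_score_mul`).
Cauchy–Schwarz and Jensen alone would lose the normalization. The missing factor `n / (n + 1)` is
the variance drop (`succ_mul_integral_sq_translateAverage_le`): averaging out one variable in a
centred function of the sum shrinks its second moment by at least that factor. The result is
`succ_mul_fisher_convPow_le`, which scaling turns into monotonicity along standardized sums.

For `t → 0`, concavity of `negMulLog` bounds the initial entropy of the shorter sum by its smoothed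
entropies, hence by those of the longer sum. Upper semicontinuity (`le_integral_negMulLog`), which
is Fatou's lemma for the nonnegative deficit in Gibbs' inequality, then reaches the entropy of the
longer sum. If the entropy integral of the shorter sum diverges, its entropy is `⊥` and nothing is
left to prove. -/

/-! ### The heat kernel: derivatives and domination. -/

/-- The heat kernel on the line: the density of the centred Gaussian law of variance `t`. -/
noncomputable def heatKernel (t x : ℝ) : ℝ := (√(2 * π * t))⁻¹ * exp (-x ^ 2 / (2 * t))

/-- The space derivative of the heat kernel. -/
noncomputable def heatKernelDx (t x : ℝ) : ℝ := -(x / t) * heatKernel t x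

/-- The second space derivative of the heat kernel. -/
noncomputable def heatKernelDxx (t x : ℝ) : ℝ := (x ^ 2 / t ^ 2 - 1 / t) * heatKernel t x

lemma heatKernel_pos {t : ℝ} (ht : 0 < t) (x : ℝ) : 0 < heatKernel t x := by
  unfold heatKernel; positivity

lemma continuous_heatKernel (t : ℝ) : Continuous (heatKernel t) := by
  unfold heatKernel; fun_prop

lemma continuous_heatKernelDx (t : ℝ) : Continuous (heatKernelDx t) := by
  unfold heatKernelDx heatKernel; fun_prop

lemma continuous_heatKernelDxx (t : ℝ) : Continuous (heatKernelDxx t) := by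
  unfold heatKernelDxx heatKernel; fun_prop

lemma heatKernel_eq_gaussianPDFReal {t : ℝ} (ht : 0 ≤ t) (x : ℝ) :
    heatKernel t x = gaussianPDFReal 0 t.toNNReal x := by
  simp [heatKernel, gaussianPDFReal, Real.coe_toNNReal t ht]

lemma hasDerivAt_heatKernel (t x : ℝ) : HasDerivAt (heatKernel t) (heatKernelDx t x) x := by
  have h : HasDerivAt (fun x : ℝ => -x ^ 2 / (2 * t)) (-(2 * x) / (2 * t)) x := by
    simpa using ((hasDerivAt_pow 2 x).neg).div_const (2 * t)
  refine (h.exp.const_mul (√(2 * π * t))⁻¹).congr_deriv ?_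
  unfold heatKernelDx heatKernel
  have h2 : -(2 * x) / (2 * t) = -(x / t) := by
    rw [neg_div, mul_div_mul_left x t (by norm_num : (2 : ℝ) ≠ 0)]
  rw [h2]
  ring

lemma hasDerivAt_heatKernelDx (t x : ℝ) : HasDerivAt (heatKernelDx t) (heatKernelDxx t x) x := by
  have h : HasDerivAt (fun x : ℝ => -(x / t)) (-(1 / t)) x := ((hasDerivAt_id x).div_const t).neg
  refine (h.mul (hasDerivAt_heatKernel t x)).congr_deriv ?_
  unfold heatKernelDxx heatKernelDx
  ring

lemma hasDerivAt_heatKernel_time {t : ℝ} (ht : 0 < t) (x : ℝ) :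
    HasDerivAt (fun t => heatKernel t x) (heatKernelDxx t x / 2) t := by
  have hs : HasDerivAt (fun t : ℝ => 2 * π * t) (2 * π) t := by
    simpa using (hasDerivAt_id t).const_mul (2 * π)
  have h0 : 2 * π * t ≠ 0 := by positivity
  have hsq : √(2 * π * t) ≠ 0 := by positivity
  have h1 : HasDerivAt (fun t : ℝ => (√(2 * π * t))⁻¹)
      (-(2 * π / (2 * √(2 * π * t))) / √(2 * π * t) ^ 2) t := (hs.sqrt h0).inv hsq
  have h2 : HasDerivAt (fun t : ℝ => -x ^ 2 / (2 * t)) (x ^ 2 / (2 * t ^ 2)) t := by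
    have h3 : HasDerivAt (fun t : ℝ => 2 * t) 2 t := by
      simpa using (hasDerivAt_id t).const_mul (2 : ℝ)
    refine ((hasDerivAt_const t (-x ^ 2)).div h3 (by positivity)).congr_deriv ?_
    field_simp
    ring
  refine (h1.mul h2.exp).congr_deriv ?_
  unfold heatKernelDxx heatKernel
  have h5 : √(2 * π * t) ^ 2 = 2 * π * t := Real.sq_sqrt (by positivity)
  rw [h5]
  field_simp
  ring

lemma poly_mul_exp_le {c : ℝ} (hc : 0 < c) (x : ℝ) : x ^ 2 * exp (-x ^ 2 / c) ≤ c := by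
  have h := Real.add_one_le_exp (x ^ 2 / c)
  have h1 : x ^ 2 / c ≤ exp (x ^ 2 / c) := by linarith
  have h2 : exp (-x ^ 2 / c) * exp (x ^ 2 / c) = 1 := by
    rw [← exp_add, neg_div, neg_add_cancel, exp_zero]
  have h3 : x ^ 2 ≤ c * exp (x ^ 2 / c) := by
    rw [div_le_iff₀ hc] at h1; linarith
  calc x ^ 2 * exp (-x ^ 2 / c) ≤ (c * exp (x ^ 2 / c)) * exp (-x ^ 2 / c) := by gcongr
    _ = c * (exp (-x ^ 2 / c) * exp (x ^ 2 / c)) := by ring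
    _ = c := by rw [h2, mul_one]

/-- Near a time `t`, the kernel and its derivatives are dominated by the kernel at time `4 * t`. -/
lemma exists_heatKernel_dominated {t : ℝ} (ht : 0 < t) : ∃ C : ℝ, 0 < C ∧
    ∀ s ∈ Ioo (t / 2) (2 * t), ∀ x : ℝ, (1 + x ^ 2) * heatKernel s x ≤ C * heatKernel (4 * t) x ∧
      |heatKernelDx s x| ≤ C * heatKernel (4 * t) x ∧
      |heatKernelDxx s x| ≤ C * heatKernel (4 * t) x := by
  -- `A + B * x ^ 2` majorizes all three multipliers of `heatKernel s x` at once, since `s > t / 2`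
  -- gives `1 / s ≤ 2 / t` and `1 / s ^ 2 ≤ 4 / t ^ 2`.
  set A : ℝ := 1 + 2 / t with hA
  set B : ℝ := 1 + 2 / t + 4 / t ^ 2 with hB
  have hA0 : 0 < A := by positivity
  have hB0 : 0 < B := by positivity
  set C : ℝ := (√(π * t))⁻¹ * (A + B * (8 * t)) * √(2 * π * (4 * t)) with hC
  have key : ∀ s ∈ Ioo (t / 2) (2 * t), ∀ x : ℝ,
      (A + B * x ^ 2) * heatKernel s x ≤ C * heatKernel (4 * t) x := by
    rintro s ⟨hs1, hs2⟩ x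
    have hs : 0 < s := by linarith
    -- The Gaussian factor is split into two equal ones: the first absorbs the quadratic polynomial,
    -- the second is the kernel at time `4 * t` up to a constant.
    have e1 : heatKernel s x ≤ (√(π * t))⁻¹ * (exp (-x ^ 2 / (8 * t)) * exp (-x ^ 2 / (8 * t))) := by
      unfold heatKernel
      rw [← exp_add]
      gcongr ?_ * exp ?_
      · gcongr ?_⁻¹
        apply Real.sqrt_le_sqrt
        nlinarith [Real.pi_pos]
      · have : -x ^ 2 / (8 * t) + -x ^ 2 / (8 * t) = -(x ^ 2 / (4 * t)) := by field_simp; ring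
        rw [this, neg_div, neg_le_neg_iff]
        exact div_le_div_of_nonneg_left (sq_nonneg x) (by positivity) (by linarith)
    have e2 := poly_mul_exp_le (show 0 < 8 * t by positivity) x
    have e3 : exp (-x ^ 2 / (8 * t)) ≤ 1 := by
      rw [exp_le_one_iff, neg_div]; simp; positivity
    calc (A + B * x ^ 2) * heatKernel s x
        ≤ (A + B * x ^ 2) * ((√(π * t))⁻¹ * (exp (-x ^ 2 / (8 * t)) * exp (-x ^ 2 / (8 * t)))) := by
          gcongr
      _ = (√(π * t))⁻¹ * (A * exp (-x ^ 2 / (8 * t)) + B * (x ^ 2 * exp (-x ^ 2 / (8 * t))))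
            * exp (-x ^ 2 / (8 * t)) := by ring
      _ ≤ (√(π * t))⁻¹ * (A * 1 + B * (8 * t)) * exp (-x ^ 2 / (8 * t)) := by gcongr
      _ = C * heatKernel (4 * t) x := by
          rw [hC]; unfold heatKernel
          have : √(2 * π * (4 * t)) ≠ 0 := by positivity
          rw [show 2 * (4 * t) = 8 * t by ring]
          field_simp
  refine ⟨C, by positivity, fun s hs x => ?_⟩
  have hs0 : 0 < s := by linarith [hs.1]
  have hK := heatKernel_pos hs0 x
  have h1s : 1 / s ≤ 2 / t := by
    rw [div_le_div_iff₀ hs0 ht]; linarith [hs.1]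
  have h1s0 : 0 ≤ 1 / s := by positivity
  have h2s : 1 / s ^ 2 ≤ 4 / t ^ 2 := by
    calc 1 / s ^ 2 = (1 / s) ^ 2 := by ring
      _ ≤ (2 / t) ^ 2 := by gcongr
      _ = 4 / t ^ 2 := by ring
  have hx : |x| ≤ 1 + x ^ 2 := by
    rw [abs_le]; constructor <;> nlinarith [sq_nonneg (x - 1), sq_nonneg (x + 1)]
  have ht2 : 0 < 2 / t := by positivity
  have ht4 : 0 < 4 / t ^ 2 := by positivity
  refine ⟨(mul_le_mul_of_nonneg_right ?_ hK.le).trans (key s hs x), ?_, ?_⟩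
  · rw [hA, hB]; nlinarith [sq_nonneg x]
  · unfold heatKernelDx
    rw [abs_mul, abs_of_pos hK]
    refine (mul_le_mul_of_nonneg_right ?_ hK.le).trans (key s hs x)
    rw [abs_neg, abs_div, abs_of_pos hs0]
    calc |x| / s = |x| * (1 / s) := by ring
      _ ≤ (1 + x ^ 2) * (2 / t) := by gcongr
      _ ≤ A + B * x ^ 2 := by rw [hA, hB]; nlinarith [sq_nonneg x]
  · unfold heatKernelDxx
    rw [abs_mul, abs_of_pos hK]
    refine (mul_le_mul_of_nonneg_right ?_ hK.le).trans (key s hs x)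
    have : |x ^ 2 / s ^ 2 - 1 / s| ≤ x ^ 2 / s ^ 2 + 1 / s := by
      refine (abs_sub _ _).trans_eq ?_
      rw [abs_of_nonneg (by positivity : 0 ≤ x ^ 2 / s ^ 2), abs_of_nonneg h1s0]
    refine this.trans ?_
    calc x ^ 2 / s ^ 2 + 1 / s = x ^ 2 * (1 / s ^ 2) + 1 / s := by ring
      _ ≤ x ^ 2 * (4 / t ^ 2) + 2 / t := by gcongr
      _ ≤ A + B * x ^ 2 := by rw [hA, hB]; nlinarith [sq_nonneg x]

lemma heatKernel_le {t : ℝ} (ht : 0 < t) (x : ℝ) : heatKernel t x ≤ (√(2 * π * t))⁻¹ := by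
  unfold heatKernel
  refine mul_le_of_le_one_right (by positivity) ?_
  rw [exp_le_one_iff, neg_div]; simp; positivity

/-- Near a time `t`, the kernel and its derivatives are uniformly bounded. -/
lemma exists_heatKernel_bounded {t : ℝ} (ht : 0 < t) : ∃ C : ℝ, 0 < C ∧
    ∀ s ∈ Ioo (t / 2) (2 * t), ∀ x : ℝ, |heatKernel s x| ≤ C ∧
      |heatKernelDx s x| ≤ C ∧ |heatKernelDxx s x| ≤ C := by
  obtain ⟨C, hC, h⟩ := exists_heatKernel_dominated ht
  have h4 := heatKernel_le (show 0 < 4 * t by positivity)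
  refine ⟨C * (√(2 * π * (4 * t)))⁻¹, by positivity, fun s hs x => ?_⟩
  obtain ⟨h1, h2, h3⟩ := h s hs x
  have hK := heatKernel_pos (show 0 < s by linarith [hs.1]) x
  have h5 : C * heatKernel (4 * t) x ≤ C * (√(2 * π * (4 * t)))⁻¹ := by gcongr; exact h4 x
  refine ⟨?_, h2.trans h5, h3.trans h5⟩
  rw [abs_of_pos hK]
  nlinarith [sq_nonneg x, mul_nonneg (sq_nonneg x) hK.le]

lemma mem_Ioo_half_double {t : ℝ} (ht : 0 < t) : t ∈ Ioo (t / 2) (2 * t) :=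
  ⟨by linarith, by linarith⟩

lemma integrable_heatKernel {t : ℝ} (ht : 0 < t) : Integrable (heatKernel t) := by
  have := integrable_gaussianPDFReal 0 t.toNNReal
  exact this.congr (ae_of_all _ fun x => (heatKernel_eq_gaussianPDFReal ht.le x).symm)

lemma integral_heatKernel {t : ℝ} (ht : 0 < t) : ∫ x, heatKernel t x = 1 := by
  simp_rw [heatKernel_eq_gaussianPDFReal ht.le]
  exact integral_gaussianPDFReal_eq_one 0 (by simpa using ht)

lemma log_heatKernel {t : ℝ} (ht : 0 < t) (x : ℝ) :
    log (heatKernel t x) = -(log (2 * π * t) / 2) - x ^ 2 / (2 * t) := by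
  unfold heatKernel
  rw [log_mul (by positivity) (by positivity), log_inv, log_exp, Real.log_sqrt (by positivity)]
  ring

/-! ### Convolution of a function with a finite measure. -/

section SmoothingByMeasure

variable {σ : Measure ℝ} [IsFiniteMeasure σ] {φ φ' : ℝ → ℝ} {C : ℝ}

lemma integrable_comp_sub (hφ : Continuous φ) (hC : ∀ x, |φ x| ≤ C) (x : ℝ) :
    Integrable (fun y => φ (x - y)) σ :=
  Integrable.of_bound (by fun_prop) C (ae_of_all _ fun y => hC (x - y))

lemma continuous_integral_comp_sub (hφ : Continuous φ) (hC : ∀ x, |φ x| ≤ C) :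
    Continuous fun x => ∫ y, φ (x - y) ∂σ :=
  continuous_of_dominated (bound := fun _ => C)
    (fun _ => (by fun_prop : Continuous _).aestronglyMeasurable)
    (fun x => ae_of_all _ fun y => hC (x - y)) (integrable_const C)
    (ae_of_all _ fun y => by fun_prop)

lemma hasDerivAt_integral_comp_sub (hφ : Continuous φ) {D : ℝ} (hD : ∀ x, |φ x| ≤ D)
    (hφ' : Continuous φ') (hC : ∀ x, |φ' x| ≤ C) (hd : ∀ x, HasDerivAt φ (φ' x) x) (x : ℝ) :
    HasDerivAt (fun x => ∫ y, φ (x - y) ∂σ) (∫ y, φ' (x - y) ∂σ) x := by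
  refine (hasDerivAt_integral_of_dominated_loc_of_deriv_le (bound := fun _ => C)
    (F' := fun x y => φ' (x - y)) univ_mem
    (Eventually.of_forall fun x => (by fun_prop : Continuous _).aestronglyMeasurable)
    (integrable_comp_sub hφ hD x) (by fun_prop : Continuous _).aestronglyMeasurable
    (ae_of_all _ fun y z _ => hC (z - y)) (integrable_const C) (ae_of_all _ fun y z _ => ?_)).2
  exact (hd (z - y)).comp_sub_const z y

lemma integrable_prod_comp_sub (hφm : Measurable φ) (hφ : Integrable φ) :
    Integrable (fun p : ℝ × ℝ => φ (p.1 - p.2)) (volume.prod σ) := by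
  rw [integrable_prod_iff' (by fun_prop : Measurable _).aestronglyMeasurable]
  refine ⟨ae_of_all _ fun y => hφ.comp_sub_right y, ?_⟩
  have : (fun y : ℝ => ∫ x : ℝ, ‖φ (x - y)‖) = fun _ => ∫ x, ‖φ x‖ := by
    ext y
    exact integral_sub_right_eq_self (fun x => ‖φ x‖) y
  simp only [this]
  exact integrable_const _

lemma integrable_integral_comp_sub (hφm : Measurable φ) (hφ : Integrable φ) :
    Integrable (fun x => ∫ y, φ (x - y) ∂σ) :=
  (integrable_prod_comp_sub hφm hφ).integral_prod_left

lemma integral_integral_comp_sub [IsProbabilityMeasure σ] (hφm : Measurable φ)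
    (hφ : Integrable φ) : ∫ x, ∫ y, φ (x - y) ∂σ = ∫ x, φ x := by
  rw [integral_integral_swap (integrable_prod_comp_sub hφm hφ)]
  have : ∀ y : ℝ, ∫ x : ℝ, φ (x - y) = ∫ x, φ x := fun y => integral_sub_right_eq_self φ y
  simp [this]

lemma conv_withDensity {h : ℝ → ENNReal} (hh : Measurable h)
    [SFinite (volume.withDensity h)] :
    σ ∗ volume.withDensity h = volume.withDensity fun x => ∫⁻ y, h (x - y) ∂σ := by
  ext s hs
  have hm : Measurable fun x => ∫⁻ y, h (x - y) ∂σ :=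
    Measurable.lintegral_prod_right (f := fun x y : ℝ => h (x - y)) (by fun_prop)
  rw [← lintegral_indicator_one hs, Measure.lintegral_conv (measurable_one.indicator hs),
    withDensity_apply _ hs]
  have h1 : ∀ y : ℝ, ∫⁻ z, s.indicator 1 (y + z) ∂(volume.withDensity h)
      = ∫⁻ x, h (x - y) * s.indicator 1 x := by
    intro y
    have hm1 : Measurable fun z => s.indicator (1 : ℝ → ENNReal) (y + z) :=
      (measurable_one.indicator hs).comp (measurable_const_add y)
    rw [lintegral_withDensity_eq_lintegral_mul _ hh hm1]
    rw [← lintegral_add_left_eq_self (fun x => h (x - y) * s.indicator 1 x) y]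
    simp
  simp_rw [h1]
  rw [lintegral_lintegral_swap]
  · rw [← lintegral_indicator hs]
    refine lintegral_congr fun x => ?_
    rw [lintegral_mul_const _ (by fun_prop)]
    by_cases hx : x ∈ s <;> simp [hx]
  · refine Measurable.aemeasurable ?_
    have : Measurable (s.indicator (1 : ℝ → ENNReal)) := measurable_one.indicator hs
    fun_prop

end SmoothingByMeasure

/-! ### The heat flow of a probability law. -/

/-- The density of the law `σ` after running the heat flow for time `t`. -/
noncomputable def heat (σ : Measure ℝ) (t x : ℝ) : ℝ := ∫ y, heatKernel t (x - y) ∂σ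

/-- The space derivative of `heat`. -/
noncomputable def heatDx (σ : Measure ℝ) (t x : ℝ) : ℝ := ∫ y, heatKernelDx t (x - y) ∂σ

/-- The second space derivative of `heat`. -/
noncomputable def heatDxx (σ : Measure ℝ) (t x : ℝ) : ℝ := ∫ y, heatKernelDxx t (x - y) ∂σ

section Heat

variable {σ : Measure ℝ} {t : ℝ}

lemma integrable_heatKernel_sub [IsFiniteMeasure σ] (ht : 0 < t) (x : ℝ) :
    Integrable (fun y => heatKernel t (x - y)) σ := by
  obtain ⟨C, -, h⟩ := exists_heatKernel_bounded ht
  exact integrable_comp_sub (continuous_heatKernel t)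
    (fun x => (h t (mem_Ioo_half_double ht) x).1) x

lemma integrable_heatKernelDx_sub [IsFiniteMeasure σ] (ht : 0 < t) (x : ℝ) :
    Integrable (fun y => heatKernelDx t (x - y)) σ := by
  obtain ⟨C, -, h⟩ := exists_heatKernel_bounded ht
  exact integrable_comp_sub (continuous_heatKernelDx t)
    (fun x => (h t (mem_Ioo_half_double ht) x).2.1) x

lemma integrable_heatKernelDxx_sub [IsFiniteMeasure σ] (ht : 0 < t) (x : ℝ) :
    Integrable (fun y => heatKernelDxx t (x - y)) σ := by
  obtain ⟨C, -, h⟩ := exists_heatKernel_bounded ht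
  exact integrable_comp_sub (continuous_heatKernelDxx t)
    (fun x => (h t (mem_Ioo_half_double ht) x).2.2) x

lemma continuous_heat [IsFiniteMeasure σ] (ht : 0 < t) : Continuous (heat σ t) := by
  obtain ⟨C, -, h⟩ := exists_heatKernel_bounded ht
  exact continuous_integral_comp_sub (continuous_heatKernel t)
    (fun x => (h t (mem_Ioo_half_double ht) x).1)

lemma continuous_heatDx [IsFiniteMeasure σ] (ht : 0 < t) : Continuous (heatDx σ t) := by
  obtain ⟨C, -, h⟩ := exists_heatKernel_bounded ht
  exact continuous_integral_comp_sub (continuous_heatKernelDx t)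
    (fun x => (h t (mem_Ioo_half_double ht) x).2.1)

lemma continuous_heatDxx [IsFiniteMeasure σ] (ht : 0 < t) : Continuous (heatDxx σ t) := by
  obtain ⟨C, -, h⟩ := exists_heatKernel_bounded ht
  exact continuous_integral_comp_sub (continuous_heatKernelDxx t)
    (fun x => (h t (mem_Ioo_half_double ht) x).2.2)

lemma hasDerivAt_heat [IsFiniteMeasure σ] (ht : 0 < t) (x : ℝ) :
    HasDerivAt (heat σ t) (heatDx σ t x) x := by
  obtain ⟨C, -, h⟩ := exists_heatKernel_bounded ht
  exact hasDerivAt_integral_comp_sub (continuous_heatKernel t)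
    (fun x => (h t (mem_Ioo_half_double ht) x).1) (continuous_heatKernelDx t)
    (fun x => (h t (mem_Ioo_half_double ht) x).2.1) (hasDerivAt_heatKernel t) x

lemma hasDerivAt_heatDx [IsFiniteMeasure σ] (ht : 0 < t) (x : ℝ) :
    HasDerivAt (heatDx σ t) (heatDxx σ t x) x := by
  obtain ⟨C, -, h⟩ := exists_heatKernel_bounded ht
  exact hasDerivAt_integral_comp_sub (continuous_heatKernelDx t)
    (fun x => (h t (mem_Ioo_half_double ht) x).2.1) (continuous_heatKernelDxx t)
    (fun x => (h t (mem_Ioo_half_double ht) x).2.2) (hasDerivAt_heatKernelDx t) x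

lemma Ioo_half_double_mem_nhds (ht : 0 < t) : Ioo (t / 2) (2 * t) ∈ 𝓝 t :=
  Ioo_mem_nhds (by linarith) (by linarith)

/-- The heat equation. -/
lemma hasDerivAt_heat_time [IsFiniteMeasure σ] (ht : 0 < t) (x : ℝ) :
    HasDerivAt (fun t => heat σ t x) (heatDxx σ t x / 2) t := by
  obtain ⟨C, -, h⟩ := exists_heatKernel_bounded ht
  have hc := fun s => continuous_heatKernel s
  have hc2 := continuous_heatKernelDxx t
  have := (hasDerivAt_integral_of_dominated_loc_of_deriv_le (μ := σ) (bound := fun _ => C / 2)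
    (F := fun s y => heatKernel s (x - y))
    (F' := fun s y => heatKernelDxx s (x - y) / 2) (Ioo_half_double_mem_nhds ht)
    (Eventually.of_forall fun s => (by fun_prop : Continuous _).aestronglyMeasurable)
    (integrable_heatKernel_sub ht x) (by fun_prop : Continuous _).aestronglyMeasurable
    (ae_of_all _ fun y s hs => ?_) (integrable_const _) (ae_of_all _ fun y s hs => ?_)).2
  · rwa [integral_div] at this
  · rw [norm_div, Real.norm_eq_abs, Real.norm_two]
    have := (h s hs (x - y)).2.2
    gcongr
  · exact hasDerivAt_heatKernel_time (by linarith [hs.1]) _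

variable [IsProbabilityMeasure σ]

lemma heat_pos (ht : 0 < t) (x : ℝ) : 0 < heat σ t x := by
  unfold heat
  rw [integral_pos_iff_support_of_nonneg (fun y => (heatKernel_pos ht _).le)
    (integrable_heatKernel_sub ht x)]
  have : (Function.support fun y => heatKernel t (x - y)) = univ := by
    ext y; simp [(heatKernel_pos ht (x - y)).ne']
  simp [this]

lemma heat_le (ht : 0 < t) (x : ℝ) : heat σ t x ≤ (√(2 * π * t))⁻¹ := by
  have := integral_mono (integrable_heatKernel_sub (σ := σ) ht x) (integrable_const _)
    (fun y => heatKernel_le ht (x - y))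
  rw [integral_const, probReal_univ, one_smul] at this
  exact this

lemma integrable_heat (ht : 0 < t) : Integrable (heat σ t) :=
  integrable_integral_comp_sub (continuous_heatKernel t).measurable (integrable_heatKernel ht)

lemma integral_heat (ht : 0 < t) : ∫ x, heat σ t x = 1 := by
  rw [← integral_heatKernel ht]
  exact integral_integral_comp_sub (continuous_heatKernel t).measurable (integrable_heatKernel ht)

lemma integrable_heatKernelDx (ht : 0 < t) : Integrable (heatKernelDx t) := by
  obtain ⟨C, -, h⟩ := exists_heatKernel_dominated ht
  exact ((integrable_heatKernel (show 0 < 4 * t by positivity)).const_mul C).mono'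
    (continuous_heatKernelDx t).aestronglyMeasurable
    (ae_of_all _ fun x => (h t (mem_Ioo_half_double ht) x).2.1)

lemma integrable_heatKernelDxx (ht : 0 < t) : Integrable (heatKernelDxx t) := by
  obtain ⟨C, -, h⟩ := exists_heatKernel_dominated ht
  exact ((integrable_heatKernel (show 0 < 4 * t by positivity)).const_mul C).mono'
    (continuous_heatKernelDxx t).aestronglyMeasurable
    (ae_of_all _ fun x => (h t (mem_Ioo_half_double ht) x).2.2)

lemma integrable_heatDx (ht : 0 < t) : Integrable (heatDx σ t) :=
  integrable_integral_comp_sub (continuous_heatKernelDx t).measurable (integrable_heatKernelDx ht)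

lemma integrable_heatDxx (ht : 0 < t) : Integrable (heatDxx σ t) :=
  integrable_integral_comp_sub (continuous_heatKernelDxx t).measurable
    (integrable_heatKernelDxx ht)

lemma integral_heatDx (ht : 0 < t) : ∫ x, heatDx σ t x = 0 :=
  integral_eq_zero_of_hasDerivAt_of_integrable (hasDerivAt_heat ht) (integrable_heatDx ht)
    (integrable_heat ht)

lemma exists_heat_dominated (ht : 0 < t) : ∃ C : ℝ, 0 < C ∧
    ∀ s ∈ Ioo (t / 2) (2 * t), ∀ x : ℝ, |heatDx σ s x| ≤ C * heat σ (4 * t) x ∧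
      |heatDxx σ s x| ≤ C * heat σ (4 * t) x := by
  obtain ⟨C, hC, h⟩ := exists_heatKernel_dominated ht
  have h4 : 0 < 4 * t := by positivity
  refine ⟨C, hC, fun s hs x => ⟨?_, ?_⟩⟩
  · unfold heat heatDx
    rw [← integral_const_mul]
    exact norm_integral_le_of_norm_le (f := fun y => heatKernelDx s (x - y))
      ((integrable_heatKernel_sub h4 x).const_mul C)
      (ae_of_all _ fun y => (h s hs (x - y)).2.1)
  · unfold heat heatDxx
    rw [← integral_const_mul]
    exact norm_integral_le_of_norm_le (f := fun y => heatKernelDxx s (x - y))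
      ((integrable_heatKernel_sub h4 x).const_mul C)
      (ae_of_all _ fun y => (h s hs (x - y)).2.2)

/-- The pointwise bound on the Fisher information density. -/
lemma heatDx_sq_le (ht : 0 < t) (x : ℝ) :
    heatDx σ t x ^ 2 / heat σ t x ≤ heatDxx σ t x + heat σ t x / t := by
  have ha := heat_pos (σ := σ) ht x
  set a := heat σ t x with ha'
  set b := heatDx σ t x with hb'
  -- The expression is `((x - y) / t + b / a) ^ 2` times the kernel. Its integral over `y` is a
  -- quadratic polynomial in the shift, and `b / a`, the score at `x`, is the minimizing value.
  have hpt : ∀ y, 0 ≤ heatKernelDxx t (x - y) + heatKernel t (x - y) / t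
      - 2 * (b / a) * heatKernelDx t (x - y) + (b / a) ^ 2 * heatKernel t (x - y) := by
    intro y
    have : heatKernelDxx t (x - y) + heatKernel t (x - y) / t
      - 2 * (b / a) * heatKernelDx t (x - y) + (b / a) ^ 2 * heatKernel t (x - y)
      = ((x - y) / t + b / a) ^ 2 * heatKernel t (x - y) := by
      unfold heatKernelDxx heatKernelDx; ring
    rw [this]
    have := heatKernel_pos ht (x - y)
    positivity
  have h0 := integral_nonneg_of_ae (μ := σ) (ae_of_all _ hpt)
  have i1 := integrable_heatKernelDxx_sub (σ := σ) ht x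
  have i2 := integrable_heatKernel_sub (σ := σ) ht x
  have i3 := integrable_heatKernelDx_sub (σ := σ) ht x
  have i4 : Integrable (fun y => heatKernelDxx t (x - y) + heatKernel t (x - y) / t) σ :=
    i1.add (i2.div_const t)
  have i5 : Integrable (fun y => heatKernelDxx t (x - y) + heatKernel t (x - y) / t
      - 2 * (b / a) * heatKernelDx t (x - y)) σ := i4.sub (i3.const_mul _)
  rw [integral_add i5 (i2.const_mul _),
    integral_sub i4 (i3.const_mul _), integral_add i1 (i2.div_const t),
    integral_div, integral_const_mul, integral_const_mul] at h0
  change 0 ≤ heatDxx σ t x + a / t - 2 * (b / a) * b + (b / a) ^ 2 * a at h0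
  have e : - 2 * (b / a) * b + (b / a) ^ 2 * a = - (b ^ 2 / a) := by
    field_simp; ring
  linarith

/-- No moment assumption is needed: the pointwise bound dominates the Fisher density by integrable
functions. -/
lemma integrable_fisher (ht : 0 < t) : Integrable fun x => heatDx σ t x ^ 2 / heat σ t x := by
  refine ((integrable_heatDxx (σ := σ) ht).add ((integrable_heat (σ := σ) ht).div_const t)).mono'
    (((continuous_heatDx ht).pow 2).div (continuous_heat ht)
      fun x => (heat_pos (σ := σ) ht x).ne').aestronglyMeasurable (ae_of_all _ fun x => ?_)
  rw [Real.norm_of_nonneg (div_nonneg (sq_nonneg _) (heat_pos (σ := σ) ht x).le)]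
  exact heatDx_sq_le ht x

lemma conv_gaussianReal (ht : 0 < t) :
    σ ∗ gaussianReal 0 t.toNNReal = volume.withDensity fun x => ENNReal.ofReal (heat σ t x) := by
  have hv : t.toNNReal ≠ 0 := by simpa using ht
  have hp : IsProbabilityMeasure (gaussianReal 0 t.toNNReal) := inferInstance
  rw [gaussianReal_of_var_ne_zero 0 hv] at hp ⊢
  rw [conv_withDensity (measurable_gaussianPDF _ _)]
  congr 1
  ext x
  unfold heat gaussianPDF
  rw [ofReal_integral_eq_lintegral_ofReal (integrable_heatKernel_sub ht x)
    (ae_of_all _ fun y => (heatKernel_pos ht _).le)]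
  simp_rw [heatKernel_eq_gaussianPDFReal ht.le]

/-- A smoothed law can arise from several pairs (initial law, time). Continuity upgrades
almost-everywhere equality of the densities to equality everywhere, so Fisher information depends
only on the smoothed law. -/
lemma heat_eq_of_conv_eq {τ : Measure ℝ} [IsProbabilityMeasure τ] {s : ℝ} (ht : 0 < t) (hs : 0 < s)
    (h : σ ∗ gaussianReal 0 t.toNNReal = τ ∗ gaussianReal 0 s.toNNReal) : heat σ t = heat τ s := by
  rw [conv_gaussianReal ht, conv_gaussianReal hs, withDensity_eq_iff_of_sigmaFinite] at h
  · refine (continuous_heat ht).ae_eq_iff_eq volume (continuous_heat hs) |>.1 ?_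
    filter_upwards [h] with x hx
    rwa [ENNReal.ofReal_eq_ofReal_iff (heat_pos ht x).le (heat_pos hs x).le] at hx
  · exact (continuous_heat ht).measurable.ennreal_ofReal.aemeasurable
  · exact (continuous_heat hs).measurable.ennreal_ofReal.aemeasurable

lemma integral_sq_heatKernel_sub (ht : 0 < t) (y : ℝ) :
    Integrable (fun x => x ^ 2 * heatKernel t (x - y)) ∧
      ∫ x, x ^ 2 * heatKernel t (x - y) = y ^ 2 + t := by
  have hv : t.toNNReal ≠ 0 := by simpa using ht
  have hk : ∀ x, gaussianPDFReal y t.toNNReal x = heatKernel t (x - y) := by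
    intro x; simp [heatKernel, gaussianPDFReal, Real.coe_toNNReal t ht.le]
  have hm : MemLp id 2 (gaussianReal y t.toNNReal) := memLp_id_gaussianReal' 2 (by simp)
  constructor
  · have h := hm.integrable_sq
    rw [gaussianReal_of_var_ne_zero y hv, integrable_withDensity_iff (measurable_gaussianPDF _ _)
      (ae_of_all _ fun x => gaussianPDF_lt_top)] at h
    simpa [hk] using h
  · have h := variance_eq_sub hm
    rw [variance_id_gaussianReal] at h
    simp only [id, Pi.pow_apply, 
      integral_gaussianReal_eq_integral_smul hv, smul_eq_mul, hk,
      Real.coe_toNNReal t ht.le] at h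
    have h2 := integral_id_gaussianReal (μ := y) (v := t.toNNReal)
    simp only [integral_gaussianReal_eq_integral_smul hv, smul_eq_mul, hk] at h2
    simp_rw [mul_comm (_ ^ 2 : ℝ)]
    rw [h2] at h
    linarith

lemma integral_sq_heat (ht : 0 < t) (hσ : Integrable (fun y => y ^ 2) σ) :
    Integrable (fun x => x ^ 2 * heat σ t x) ∧
      ∫ x, x ^ 2 * heat σ t x = (∫ y, y ^ 2 ∂σ) + t := by
  have hc := continuous_heatKernel t
  have hi : Integrable (fun p : ℝ × ℝ => p.1 ^ 2 * heatKernel t (p.1 - p.2))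
      (volume.prod σ) := by
    rw [integrable_prod_iff' (by fun_prop : Continuous _).aestronglyMeasurable]
    refine ⟨ae_of_all _ fun y => (integral_sq_heatKernel_sub ht y).1, ?_⟩
    have : ∀ y : ℝ, ∫ x, ‖x ^ 2 * heatKernel t (x - y)‖ = y ^ 2 + t := by
      intro y
      rw [← (integral_sq_heatKernel_sub ht y).2]
      refine integral_congr_ae (ae_of_all _ fun x => ?_)
      exact Real.norm_of_nonneg (mul_nonneg (sq_nonneg x) (heatKernel_pos ht _).le)
    simp only [this]
    exact hσ.add (integrable_const t)
  have h1 := hi.integral_prod_left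
  have h2 := integral_integral_swap (f := fun x y => x ^ 2 * heatKernel t (x - y)) hi
  simp only [integral_const_mul, (integral_sq_heatKernel_sub ht _).2] at h1 h2
  refine ⟨h1, h2.trans ?_⟩
  rw [integral_add hσ (integrable_const t)]
  simp

/-- Jensen's inequality for `exp`, with `(x - y) ^ 2 ≤ 2 * (x ^ 2 + y ^ 2)`. Thus the logarithm of
the smoothed density is at most quadratic in size, which makes entropy integrals converge under a
second moment. -/
lemma le_log_heat (ht : 0 < t) (hσ : Integrable (fun y => y ^ 2) σ) (x : ℝ) :
    -(log (2 * π * t) / 2) - (x ^ 2 + ∫ y, y ^ 2 ∂σ) / t ≤ log (heat σ t x) := by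
  rw [Real.le_log_iff_exp_le (heat_pos ht x)]
  have hi2 : Integrable (fun y => x ^ 2 + y ^ 2) σ := (integrable_const _).add hσ
  have hint : Integrable (fun y => -(log (2 * π * t) / 2) - (x ^ 2 + y ^ 2) / t) σ :=
    (integrable_const _).sub (hi2.div_const t)
  have hpt : ∀ y : ℝ, exp (-(log (2 * π * t) / 2) - (x ^ 2 + y ^ 2) / t)
      ≤ heatKernel t (x - y) := by
    intro y
    rw [← exp_log (heatKernel_pos ht (x - y)), log_heatKernel ht]
    apply exp_le_exp.2
    have : (x - y) ^ 2 / (2 * t) ≤ (x ^ 2 + y ^ 2) / t := by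
      rw [div_le_div_iff₀ (by positivity) ht]
      nlinarith [sq_nonneg (x + y)]
    linarith
  have hexp : Integrable (exp ∘ fun y : ℝ => -(log (2 * π * t) / 2) - (x ^ 2 + y ^ 2) / t) σ := by
    refine (integrable_heatKernel_sub ht x).mono'
      (by fun_prop : Continuous _).aestronglyMeasurable (ae_of_all _ fun y => ?_)
    rw [Function.comp_apply, Real.norm_of_nonneg (exp_pos _).le]
    exact hpt y
  have := convexOn_exp.map_integral_le (μ := σ) continuous_exp.continuousOn isClosed_univ
    (ae_of_all _ fun _ => mem_univ _) hint hexp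
  refine le_trans (le_of_eq ?_) (this.trans (integral_mono hexp (integrable_heatKernel_sub ht x) hpt))
  congr 1
  rw [integral_sub (integrable_const _) (hi2.div_const t),
    integral_div, integral_add (integrable_const _) hσ]
  simp

lemma abs_log_heat_le (ht : 0 < t) (hσ : Integrable (fun y => y ^ 2) σ) (x : ℝ) :
    |log (heat σ t x)| ≤ |log (2 * π * t)| / 2 + (x ^ 2 + ∫ y, y ^ 2 ∂σ) / t := by
  have h1 := le_log_heat ht hσ x
  have h2 : log (heat σ t x) ≤ -(log (2 * π * t) / 2) := by
    refine (log_le_log (heat_pos ht x) (heat_le ht x)).trans_eq ?_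
    rw [log_inv, log_sqrt (by positivity)]
  have h3 : 0 ≤ (x ^ 2 + ∫ y, y ^ 2 ∂σ) / t :=
    div_nonneg (add_nonneg (sq_nonneg x) (integral_nonneg fun y => sq_nonneg y)) ht.le
  rw [abs_le]
  constructor <;> linarith [le_abs_self (log (2 * π * t)), neg_abs_le (log (2 * π * t))]

lemma integrable_sq_mul_heat_add (ht : 0 < t) (hσ : Integrable (fun y => y ^ 2) σ) (a b : ℝ) :
    Integrable (fun x => (a + b * x ^ 2) * heat σ t x) := by
  refine (((integrable_heat (σ := σ) ht).const_mul a).add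
    ((integral_sq_heat ht hσ).1.const_mul b)).congr (ae_of_all _ fun x => ?_)
  simp only [Pi.add_apply]; ring

lemma integrable_negMulLog_heat (ht : 0 < t) (hσ : Integrable (fun y => y ^ 2) σ) :
    Integrable (fun x => negMulLog (heat σ t x)) := by
  refine (integrable_sq_mul_heat_add ht hσ
    (|log (2 * π * t)| / 2 + (∫ y, y ^ 2 ∂σ) / t) (1 / t)).mono'
    (continuous_negMulLog.comp (continuous_heat (σ := σ) ht)).aestronglyMeasurable
    (ae_of_all _ fun x => ?_)
  rw [negMulLog, norm_mul, norm_neg, Real.norm_of_nonneg (heat_pos (σ := σ) ht x).le, mul_comm]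
  refine mul_le_mul_of_nonneg_right ((abs_log_heat_le ht hσ x).trans_eq ?_) (heat_pos ht x).le
  ring

end Heat

/-! ### Entropy, Fisher information and de Bruijn's identity. -/

/-- The differential entropy of the law `σ` after running the heat flow for time `t`. -/
noncomputable def heatEntropy (σ : Measure ℝ) (t : ℝ) : ℝ := ∫ x, negMulLog (heat σ t x)

/-- The Fisher information of the law `σ` after running the heat flow for time `t`. -/
noncomputable def fisher (σ : Measure ℝ) (t : ℝ) : ℝ := ∫ x, heatDx σ t x ^ 2 / heat σ t x

section DeBruijn

variable {σ : Measure ℝ} [IsProbabilityMeasure σ] {t : ℝ}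

/-- `-log u - 1` is the derivative of `negMulLog`. A bound uniform over times near `t` is what
differentiation under the integral requires. -/
lemma exists_log_heat_dominated (ht : 0 < t) (hσ : Integrable (fun y => y ^ 2) σ) :
    ∃ a b : ℝ, ∀ s ∈ Ioo (t / 2) (2 * t), ∀ x : ℝ, |-log (heat σ s x) - 1| ≤ a + b * x ^ 2 := by
  set m := ∫ y, y ^ 2 ∂σ with hm
  have hm0 : 0 ≤ m := integral_nonneg fun y => sq_nonneg y
  set L := |log (2 * π * (t / 2))| + |log (2 * π * (2 * t))| with hL
  refine ⟨L + m * (2 / t) + 1, 2 / t, fun s hs x => ?_⟩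
  have hs0 : 0 < s := by linarith [hs.1]
  have h := abs_log_heat_le hs0 hσ x
  have hl1 : log (2 * π * (t / 2)) ≤ log (2 * π * s) := by
    apply log_le_log (by positivity)
    have := hs.1.le; gcongr
  have hl2 : log (2 * π * s) ≤ log (2 * π * (2 * t)) := by
    apply log_le_log (by positivity)
    have := hs.2.le; gcongr
  have hl : |log (2 * π * s)| ≤ L := by
    rw [abs_le]
    constructor <;> linarith [neg_abs_le (log (2 * π * (t / 2))), le_abs_self (log (2 * π * (2 * t))),
      abs_nonneg (log (2 * π * (t / 2))), abs_nonneg (log (2 * π * (2 * t)))]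
  have h1s : 1 / s ≤ 2 / t := by
    rw [div_le_div_iff₀ hs0 ht]; linarith [hs.1]
  have h3 : (x ^ 2 + m) / s ≤ (x ^ 2 + m) * (2 / t) := by
    calc (x ^ 2 + m) / s = (x ^ 2 + m) * (1 / s) := by ring
      _ ≤ _ := by gcongr
  have h4 : |-log (heat σ s x) - 1| ≤ |log (heat σ s x)| + 1 := by
    refine (abs_sub _ _).trans_eq ?_
    rw [abs_neg, abs_one]
  have h5 := abs_nonneg (log (2 * π * s))
  linarith

lemma integrable_log_heat_mul (ht : 0 < t) (hσ : Integrable (fun y => y ^ 2) σ) {g : ℝ → ℝ}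
    (hg : Continuous g) {C : ℝ} (hgC : ∀ x, |g x| ≤ C * heat σ (4 * t) x) :
    Integrable fun x => (-log (heat σ t x) - 1) * g x := by
  obtain ⟨a, b, h⟩ := exists_log_heat_dominated ht hσ
  have h4 : 0 < 4 * t := by positivity
  have hc := continuous_heat (σ := σ) ht
  have hcl : Continuous fun x => log (heat σ t x) := hc.log fun x => (heat_pos ht x).ne'
  refine ((integrable_sq_mul_heat_add h4 hσ a b).const_mul C).mono'
    (by fun_prop : Continuous _).aestronglyMeasurable (ae_of_all _ fun x => ?_)
  have h1 := h t (mem_Ioo_half_double ht) x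
  rw [norm_mul, Real.norm_eq_abs, Real.norm_eq_abs]
  calc _ ≤ (a + b * x ^ 2) * (C * heat σ (4 * t) x) :=
        mul_le_mul h1 (hgC x) (abs_nonneg _) ((abs_nonneg _).trans h1)
    _ = _ := by ring

/-- **De Bruijn's identity**: along the heat flow, the entropy increases at the rate of half the
Fisher information. -/
theorem hasDerivAt_heatEntropy (ht : 0 < t) (hσ : Integrable (fun y => y ^ 2) σ) :
    HasDerivAt (heatEntropy σ) (fisher σ t / 2) t := by
  obtain ⟨a, b, hab⟩ := exists_log_heat_dominated ht hσ
  obtain ⟨C, hC, hdom⟩ := exists_heat_dominated (σ := σ) ht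
  have h4 : 0 < 4 * t := by positivity
  have hlog : Continuous fun x => log (heat σ t x) :=
    (continuous_heat ht).log fun x => (heat_pos ht x).ne'
  have hc1 := continuous_heatDx (σ := σ) ht
  have hc2 := continuous_heatDxx (σ := σ) ht
  have htm := mem_Ioo_half_double ht
  have key := (hasDerivAt_integral_of_dominated_loc_of_deriv_le (μ := volume)
    (bound := fun x => C / 2 * ((a + b * x ^ 2) * heat σ (4 * t) x))
    (F := fun s x => negMulLog (heat σ s x))
    (F' := fun s x => (-log (heat σ s x) - 1) * (heatDxx σ s x / 2)) (Ioo_half_double_mem_nhds ht)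
    (by
      filter_upwards [Ioi_mem_nhds ht] with s hs
      exact (continuous_negMulLog.comp (continuous_heat hs)).aestronglyMeasurable)
    (integrable_negMulLog_heat ht hσ) (by fun_prop : Continuous _).aestronglyMeasurable
    (ae_of_all _ fun x s hs => ?_) ((integrable_sq_mul_heat_add h4 hσ a b).const_mul _)
    (ae_of_all _ fun x s hs => ?_)).2
  -- The heat equation has produced a second space derivative; integrating by parts moves one
  -- derivative onto the logarithm and creates the Fisher density.
  · have hibp := integral_mul_deriv_eq_deriv_mul_of_integrable
      (u := fun x => -log (heat σ t x) - 1) (u' := fun x => -(heatDx σ t x / heat σ t x))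
      (v := heatDx σ t) (v' := heatDxx σ t)
      (fun x _ => ((hasDerivAt_heat ht x).log (heat_pos ht x).ne').neg.sub_const 1)
      (fun x _ => hasDerivAt_heatDx ht x)
      (integrable_log_heat_mul ht hσ hc2 fun x => (hdom t htm x).2)
      ((integrable_fisher (σ := σ) ht).neg.congr (ae_of_all _ fun x => by
        simp only [Pi.neg_apply, Pi.mul_apply]; ring))
      (integrable_log_heat_mul ht hσ hc1 fun x => (hdom t htm x).1)
    refine key.congr_deriv ?_
    have e1 : ∀ x, (-log (heat σ t x) - 1) * (heatDxx σ t x / 2)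
        = (-log (heat σ t x) - 1) * heatDxx σ t x / 2 := fun x => by ring
    simp_rw [e1]
    rw [integral_div, hibp, ← integral_neg, fisher]
    congr 1
    refine integral_congr_ae (ae_of_all _ fun x => ?_)
    simp only; ring
  · have h1 := hab s hs x
    have h2 := (hdom s hs x).2
    rw [norm_mul, Real.norm_eq_abs, norm_div, Real.norm_two, Real.norm_eq_abs]
    calc _ ≤ (a + b * x ^ 2) * (C * heat σ (4 * t) x / 2) := by
          gcongr
          exact (abs_nonneg _).trans h1
      _ = _ := by ring
  · have hs0 : 0 < s := by linarith [hs.1]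
    exact (hasDerivAt_negMulLog (heat_pos (σ := σ) hs0 x).ne').comp s (hasDerivAt_heat_time hs0 x)

end DeBruijn

/-! ### Second moments of partial averages. -/

section SquareIntegrable

variable {α β : Type*} [MeasurableSpace α] [MeasurableSpace β] {μ : Measure α} {ν : Measure β}

lemma sq_integral_le [IsProbabilityMeasure ν] {f : β → ℝ} (hf : MemLp f 2 ν) :
    (∫ y, f y ∂ν) ^ 2 ≤ ∫ y, f y ^ 2 ∂ν := by
  have h := variance_nonneg f ν
  rw [variance_eq_sub hf] at h
  simp only [Pi.pow_apply] at h
  linarith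

lemma ae_memLp_two_of_prod [SFinite μ] [SFinite ν] {F : α × β → ℝ}
    (hF : MemLp F 2 (μ.prod ν)) : ∀ᵐ x ∂μ, MemLp (fun y => F (x, y)) 2 ν := by
  filter_upwards [hF.1.prodMk_left, hF.integrable_sq.prod_right_ae] with x h1 h2
  exact (memLp_two_iff_integrable_sq h1).2 h2

variable [IsProbabilityMeasure ν] [SFinite μ]

lemma memLp_two_integral_right {F : α × β → ℝ} (hF : MemLp F 2 (μ.prod ν)) :
    MemLp (fun x => ∫ y, F (x, y) ∂ν) 2 μ := by
  have hm := hF.1.integral_prod_right'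
  refine (memLp_two_iff_integrable_sq hm).2 ?_
  refine hF.integrable_sq.integral_prod_left.mono' (hm.pow 2) ?_
  filter_upwards [ae_memLp_two_of_prod hF] with x hx
  rw [Real.norm_of_nonneg (sq_nonneg _)]
  exact sq_integral_le hx

lemma integral_sq_integral_right_le {F : α × β → ℝ} (hF : MemLp F 2 (μ.prod ν)) :
    ∫ x, (∫ y, F (x, y) ∂ν) ^ 2 ∂μ ≤ ∫ p, F p ^ 2 ∂(μ.prod ν) := by
  rw [integral_prod _ hF.integrable_sq]
  refine integral_mono_ae (memLp_two_integral_right hF).integrable_sq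
    hF.integrable_sq.integral_prod_left ?_
  filter_upwards [ae_memLp_two_of_prod hF] with x hx
  exact sq_integral_le hx

/-- The case of two variables of the variance drop inequality. -/
lemma two_mul_integral_sq_le_of_symm {k : β × β → ℝ} (hk : MemLp k 2 (ν.prod ν))
    (hsymm : ∀ y z, k (y, z) = k (z, y)) :
    2 * ∫ y, (∫ z, k (y, z) ∂ν) ^ 2 ∂ν
      ≤ (∫ y, ∫ z, k (y, z) ^ 2 ∂ν ∂ν) + (∫ y, ∫ z, k (y, z) ∂ν ∂ν) ^ 2 := by
  set a : β → ℝ := fun y => ∫ z, k (y, z) ∂ν with ha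
  set c := ∫ y, a y ∂ν with hc
  have ha2 : MemLp a 2 ν := memLp_two_integral_right hk
  have ha2' : MemLp (fun p : β × β => a p.2) 2 (ν.prod ν) :=
    ha2.comp_measurePreserving measurePreserving_snd
  -- Subtracting `a` in the variable about to be integrated out leaves `a - c`. Jensen for this
  -- difference is then `∫ a² - c² ≤ ∫ k² - ∫ a²`; symmetry of `k` evaluates the cross term.
  have hF : MemLp (fun p : β × β => k p - a p.2) 2 (ν.prod ν) := hk.sub ha2'
  have h1 := integral_sq_integral_right_le hF
  have ai : Integrable a ν := ha2.integrable one_le_two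
  have h2 : ∫ z, (∫ y, (k (z, y) - a y) ∂ν) ^ 2 ∂ν = (∫ y, a y ^ 2 ∂ν) - c ^ 2 := by
    have e : (fun z => (∫ y, (k (z, y) - a y) ∂ν) ^ 2) =ᵐ[ν] fun z => a z ^ 2 - 2 * c * a z + c ^ 2 := by
      filter_upwards [ae_memLp_two_of_prod hk] with z hz
      rw [integral_sub (hz.integrable one_le_two) ai]
      change (a z - c) ^ 2 = _
      ring
    rw [integral_congr_ae e]
    have i1 : Integrable (fun z => a z ^ 2 - 2 * c * a z) ν := ha2.integrable_sq.sub (ai.const_mul _)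
    rw [integral_add i1 (integrable_const _),
      integral_sub ha2.integrable_sq (ai.const_mul _), integral_const_mul]
    simp only [integral_const, probReal_univ, one_smul]
    rw [← hc]; ring
  have hka : Integrable (fun p : β × β => k p * a p.2) (ν.prod ν) := hk.integrable_mul ha2'
  have h3 : ∫ p, k p * a p.2 ∂(ν.prod ν) = ∫ y, a y ^ 2 ∂ν := by
    rw [integral_prod_symm _ hka]
    refine integral_congr_ae (ae_of_all _ fun y => ?_)
    simp only
    rw [integral_mul_const]
    simp_rw [hsymm _ y]
    change a y * a y = _
    ring
  have h4 : ∫ p, a p.2 ^ 2 ∂(ν.prod ν) = ∫ y, a y ^ 2 ∂ν := by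
    have := integral_prod_mul (μ := ν) (ν := ν) (fun _ : β => (1 : ℝ)) (fun y => a y ^ 2)
    simpa using this
  have h5 : ∫ p, (k p - a p.2) ^ 2 ∂(ν.prod ν) = (∫ p, k p ^ 2 ∂(ν.prod ν)) - ∫ y, a y ^ 2 ∂ν := by
    have e : ∀ p : β × β, (k p - a p.2) ^ 2 = k p ^ 2 - 2 * (k p * a p.2) + a p.2 ^ 2 :=
      fun p => by ring
    simp_rw [e]
    have i1 : Integrable (fun p : β × β => k p ^ 2 - 2 * (k p * a p.2)) (ν.prod ν) :=
      hk.integrable_sq.sub (hka.const_mul 2)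
    rw [integral_add i1 ha2'.integrable_sq,
      integral_sub hk.integrable_sq (hka.const_mul 2), integral_const_mul, h3, h4]
    ring
  rw [h5, h2, integral_prod _ hk.integrable_sq] at h1
  linarith

end SquareIntegrable

/-! ### Variance drop for sums of i.i.d. variables. -/

/-- The average of the translates `g (s + y)` over `y` with law `μ`. -/
noncomputable def translateAverage (μ : Measure ℝ) (g : ℝ → ℝ) (s : ℝ) : ℝ := ∫ y, g (s + y) ∂μ

/-- The law of a sum of `n` independent variables of law `μ`. -/
noncomputable def convPow (μ : Measure ℝ) : ℕ → Measure ℝ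
  | 0 => Measure.dirac 0
  | n + 1 => convPow μ n ∗ μ

instance isProbabilityMeasure_convPow (μ : Measure ℝ) [IsProbabilityMeasure μ] (n : ℕ) :
    IsProbabilityMeasure (convPow μ n) := by
  induction n with
  | zero => rw [convPow]; infer_instance
  | succ n ih => rw [convPow]; infer_instance

section VarianceDrop

variable {M μ : Measure ℝ} {g : ℝ → ℝ}

lemma memLp_two_add_of_conv (hg : MemLp g 2 (M ∗ μ)) :
    MemLp (fun p : ℝ × ℝ => g (p.1 + p.2)) 2 (M.prod μ) :=
  hg.comp_of_map (by fun_prop)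

variable [IsProbabilityMeasure M] [IsProbabilityMeasure μ]

lemma memLp_translateAverage (hg : MemLp g 2 (M ∗ μ)) : MemLp (translateAverage μ g) 2 M :=
  memLp_two_integral_right (memLp_two_add_of_conv hg)

lemma integral_translateAverage (hg : Integrable g (M ∗ μ)) :
    ∫ s, translateAverage μ g s ∂M = ∫ x, g x ∂(M ∗ μ) :=
  (integral_conv hg).symm

/-- With the part of law `M` frozen at `s`, the two-variable inequality applies to the symmetric
kernel `g (s + y + z)`; then integrate over `s`. The second moments of successive averages thus form
a convex sequence. -/
lemma two_mul_integral_sq_translateAverage_le (hg : MemLp g 2 ((M ∗ μ) ∗ μ)) :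
    2 * ∫ x, translateAverage μ g x ^ 2 ∂(M ∗ μ) ≤ (∫ x, g x ^ 2 ∂((M ∗ μ) ∗ μ))
      + ∫ x, translateAverage μ (translateAverage μ g) x ^ 2 ∂M := by
  have hQ := memLp_translateAverage hg
  have hQQ := memLp_translateAverage hQ
  have hg2 := hg.integrable_sq
  have i1 : Integrable (translateAverage μ fun x => g x ^ 2) (M ∗ μ) :=
    (memLp_two_add_of_conv hg).integrable_sq.integral_prod_left
  have i2 : Integrable (translateAverage μ (translateAverage μ fun x => g x ^ 2)) M := by
    have : Integrable (fun p : ℝ × ℝ => translateAverage μ (fun x => g x ^ 2) (p.1 + p.2))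
      (M.prod μ) := i1.comp_measurable (by fun_prop)
    exact this.integral_prod_left
  have i3 : Integrable (translateAverage μ fun x => translateAverage μ g x ^ 2) M :=
    (memLp_two_add_of_conv hQ).integrable_sq.integral_prod_left
  rw [← integral_translateAverage hg2, ← integral_translateAverage i1,
    ← integral_translateAverage hQ.integrable_sq, ← integral_const_mul,
    ← integral_add i2 hQQ.integrable_sq]
  refine integral_mono_ae (i3.const_mul 2) (i2.add hQQ.integrable_sq) ?_
  have hg' : MemLp g 2 (M ∗ (μ ∗ μ)) := by rwa [← Measure.conv_assoc]
  filter_upwards [ae_memLp_two_of_prod (memLp_two_add_of_conv hg')] with s hs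
  have := two_mul_integral_sq_le_of_symm (memLp_two_add_of_conv hs)
    (fun y z => by simp only [add_comm y z])
  simpa only [translateAverage, ← add_assoc] using this

/-- **Variance drop inequality** for sums of independent identically distributed variables. -/
theorem succ_mul_integral_sq_translateAverage_le (n : ℕ) : ∀ {g : ℝ → ℝ},
    MemLp g 2 (convPow μ (n + 1)) → ∫ x, g x ∂(convPow μ (n + 1)) = 0 →
    (n + 1) * ∫ x, translateAverage μ g x ^ 2 ∂(convPow μ n)
      ≤ n * ∫ x, g x ^ 2 ∂(convPow μ (n + 1)) := by
  induction n with
  | zero =>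
    intro g hg h0
    have : translateAverage μ g 0 = ∫ x, g x ∂(convPow μ (0 + 1)) := by
      simp [convPow, translateAverage]
    rw [h0] at this
    simp [convPow, this]
  | succ n ih =>
    intro g hg h0
    have hQ := memLp_translateAverage hg
    have h := two_mul_integral_sq_translateAverage_le (M := convPow μ n) hg
    have h1 := ih hQ (by rw [← h0]; exact integral_translateAverage (hg.integrable one_le_two))
    change 2 * ∫ x, translateAverage μ g x ^ 2 ∂(convPow μ (n + 1))
      ≤ (∫ x, g x ^ 2 ∂(convPow μ (n + 1 + 1))) + _ at h
    push_cast
    -- With `A` the successive second moments, combine `2 A_{n+1} ≤ A_{n+2} + A_n` with the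
    -- induction hypothesis `(n+1) A_n ≤ n A_{n+1}`.
    nlinarith

end VarianceDrop

/-! ### Scores and Fisher information of sums. -/

section FisherMonotone

variable {σ : Measure ℝ} [IsProbabilityMeasure σ] {t : ℝ}

lemma integrable_conv_gaussianReal_iff (ht : 0 < t) {g : ℝ → ℝ} :
    Integrable g (σ ∗ gaussianReal 0 t.toNNReal) ↔ Integrable fun x => g x * heat σ t x := by
  rw [conv_gaussianReal ht, integrable_withDensity_iff
    (continuous_heat ht).measurable.ennreal_ofReal (ae_of_all _ fun x => ENNReal.ofReal_lt_top)]
  simp_rw [ENNReal.toReal_ofReal (heat_pos (σ := σ) ht _).le]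

lemma integral_conv_gaussianReal (ht : 0 < t) (g : ℝ → ℝ) :
    ∫ x, g x ∂(σ ∗ gaussianReal 0 t.toNNReal) = ∫ x, g x * heat σ t x := by
  rw [conv_gaussianReal ht, integral_withDensity_eq_integral_toReal_smul
    (continuous_heat ht).measurable.ennreal_ofReal (ae_of_all _ fun x => ENNReal.ofReal_lt_top)]
  simp_rw [ENNReal.toReal_ofReal (heat_pos (σ := σ) ht _).le, smul_eq_mul, mul_comm]

/-- The score function of the law `σ` after running the heat flow for time `t`. -/
noncomputable def score (σ : Measure ℝ) (t x : ℝ) : ℝ := heatDx σ t x / heat σ t x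

lemma continuous_score (ht : 0 < t) : Continuous (score σ t) :=
  (continuous_heatDx ht).div (continuous_heat ht) fun x => (heat_pos ht x).ne'

lemma score_mul_heat (ht : 0 < t) (x : ℝ) : score σ t x * heat σ t x = heatDx σ t x :=
  div_mul_cancel₀ _ (heat_pos ht x).ne'

lemma score_sq_mul_heat (ht : 0 < t) (x : ℝ) :
    score σ t x ^ 2 * heat σ t x = heatDx σ t x ^ 2 / heat σ t x := by
  have := (heat_pos (σ := σ) ht x).ne'
  unfold score; field_simp

lemma memLp_score (ht : 0 < t) : MemLp (score σ t) 2 (σ ∗ gaussianReal 0 t.toNNReal) := by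
  refine (memLp_two_iff_integrable_sq (continuous_score ht).aestronglyMeasurable).2 ?_
  rw [integrable_conv_gaussianReal_iff ht]
  simp_rw [score_sq_mul_heat ht]
  exact integrable_fisher ht

lemma integral_score (ht : 0 < t) : ∫ x, score σ t x ∂(σ ∗ gaussianReal 0 t.toNNReal) = 0 := by
  rw [integral_conv_gaussianReal ht]
  simp_rw [score_mul_heat ht]
  exact integral_heatDx ht

lemma integral_sq_score (ht : 0 < t) :
    ∫ x, score σ t x ^ 2 ∂(σ ∗ gaussianReal 0 t.toNNReal) = fisher σ t := by
  rw [integral_conv_gaussianReal ht]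
  simp_rw [score_sq_mul_heat ht]
  rfl

variable {μ : Measure ℝ} [IsProbabilityMeasure μ]

lemma integral_conv_comp_sub {φ : ℝ → ℝ} (hφ : Continuous φ) {C : ℝ} (hC : ∀ x, |φ x| ≤ C) (x : ℝ) :
    ∫ u, φ (x - u) ∂(σ ∗ μ) = ∫ y, ∫ u, φ (x - y - u) ∂σ ∂μ := by
  rw [Measure.conv_comm, integral_conv (integrable_comp_sub hφ hC x)]
  simp_rw [sub_sub]

lemma heat_conv (ht : 0 < t) (x : ℝ) : heat (σ ∗ μ) t x = ∫ y, heat σ t (x - y) ∂μ := by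
  obtain ⟨C, -, h⟩ := exists_heatKernel_bounded ht
  exact integral_conv_comp_sub (continuous_heatKernel t)
    (fun x => (h t (mem_Ioo_half_double ht) x).1) x

lemma heatDx_conv (ht : 0 < t) (x : ℝ) : heatDx (σ ∗ μ) t x = ∫ y, heatDx σ t (x - y) ∂μ := by
  obtain ⟨C, -, h⟩ := exists_heatKernel_bounded ht
  exact integral_conv_comp_sub (continuous_heatKernelDx t)
    (fun x => (h t (mem_Ioo_half_double ht) x).2.1) x

lemma integrable_heat_sub (ht : 0 < t) (x : ℝ) : Integrable (fun y => heat σ t (x - y)) μ :=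
  integrable_comp_sub (continuous_heat ht) (fun x => by
    rw [abs_of_pos (heat_pos ht x)]; exact heat_le ht x) x

/-- Writing `heatDx` as score times density, the product of the two scores is bounded by the sum of
their squares, and each square integrates to a finite Fisher information. -/
lemma integrable_score_mul_heatDx (ht : 0 < t) :
    Integrable (fun p : ℝ × ℝ => score (σ ∗ μ) t p.1 * heatDx σ t (p.1 - p.2))
      (volume.prod μ) := by
  have hcs := continuous_score (σ := σ ∗ μ) ht
  have hcp := continuous_heat (σ := σ) ht
  have hcd := continuous_heatDx (σ := σ) ht
  have h1 : Integrable (fun p : ℝ × ℝ => score (σ ∗ μ) t p.1 ^ 2 * heat σ t (p.1 - p.2))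
      (volume.prod μ) := by
    rw [integrable_prod_iff (by fun_prop : Continuous _).aestronglyMeasurable]
    refine ⟨ae_of_all _ fun x => (integrable_heat_sub (σ := σ) (μ := μ) ht x).const_mul
      (score (σ ∗ μ) t x ^ 2), ?_⟩
    refine (integrable_fisher (σ := σ ∗ μ) ht).congr (ae_of_all _ fun x => ?_)
    simp only
    rw [← score_sq_mul_heat ht, heat_conv ht, ← integral_const_mul]
    refine integral_congr_ae (ae_of_all _ fun y => ?_)
    exact (Real.norm_of_nonneg (mul_nonneg (sq_nonneg _) (heat_pos ht _).le)).symm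
  have h2 : Integrable (fun p : ℝ × ℝ => heatDx σ t (p.1 - p.2) ^ 2 / heat σ t (p.1 - p.2))
      (volume.prod μ) :=
    integrable_prod_comp_sub (φ := fun x => heatDx σ t x ^ 2 / heat σ t x)
      (by have := hcp.measurable; have := hcd.measurable; fun_prop) (integrable_fisher ht)
  refine (h1.add h2).mono' (by fun_prop : Continuous _).aestronglyMeasurable
    (ae_of_all _ fun p => ?_)
  have hp := heat_pos (σ := σ) ht (p.1 - p.2)
  set r := score (σ ∗ μ) t p.1
  simp only [Pi.add_apply]
  rw [← score_sq_mul_heat ht, ← score_mul_heat ht]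
  set u := score σ t (p.1 - p.2)
  set q := heat σ t (p.1 - p.2)
  rw [Real.norm_eq_abs, ← mul_assoc, abs_mul, abs_of_pos hp, ← add_mul]
  gcongr
  rw [abs_le]
  constructor <;> nlinarith [sq_nonneg (r - u), sq_nonneg (r + u), sq_nonneg r, sq_nonneg u]

/-- The score of a sum tested against the score of one of the terms. -/
lemma integral_translateAverage_score_mul (ht : 0 < t) :
    ∫ x, translateAverage μ (score (σ ∗ μ) t) x * score σ t x ∂(σ ∗ gaussianReal 0 t.toNNReal)
      = fisher (σ ∗ μ) t := by
  have hint := integrable_score_mul_heatDx (σ := σ) (μ := μ) ht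
  -- The derivative of a convolution falls on the factor coming from `σ`, which brings in the score
  -- of that term without conditional expectations.
  have h0 : fisher (σ ∗ μ) t = ∫ x, ∫ y, score (σ ∗ μ) t x * heatDx σ t (x - y) ∂μ := by
    refine integral_congr_ae (ae_of_all _ fun x => ?_)
    simp only
    rw [integral_const_mul, ← heatDx_conv ht, score]
    ring
  have hint2 : Integrable (fun p : ℝ × ℝ => score (σ ∗ μ) t (p.1 + p.2) * heatDx σ t p.1)
      (volume.prod μ) := by
    have hcs := continuous_score (σ := σ ∗ μ) ht
    have hcd := continuous_heatDx (σ := σ) ht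
    have := (integrable_prod_iff' hint.1).1 hint
    rw [integrable_prod_iff' (by fun_prop : Continuous _).aestronglyMeasurable]
    refine ⟨?_, ?_⟩
    · filter_upwards [this.1] with y hy
      simpa using hy.comp_add_right y
    · refine this.2.congr (ae_of_all _ fun y => ?_)
      simp only
      rw [← integral_add_right_eq_self _ y]
      simp
  rw [integral_conv_gaussianReal ht, h0, integral_integral_swap hint]
  have h1 : ∀ y, ∫ x, score (σ ∗ μ) t x * heatDx σ t (x - y)
      = ∫ x, score (σ ∗ μ) t (x + y) * heatDx σ t x := by
    intro y
    rw [← integral_add_right_eq_self _ y]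
    simp
  simp_rw [h1]
  rw [← integral_integral_swap (f := fun x y => score (σ ∗ μ) t (x + y) * heatDx σ t x) hint2]
  refine integral_congr_ae (ae_of_all _ fun x => ?_)
  simp only
  rw [integral_mul_const, mul_assoc, score_mul_heat ht]
  rfl

/-- Expand a nonnegative squared distance between the averaged score and the score of the `n`-fold
sum, evaluate the cross term, and bound the first square by variance drop. The weights `n + 1` and
`n` make the square vanish for Gaussian `μ`, the case of equality. -/
lemma succ_mul_fisher_conv_le (ht : 0 < t) {n : ℕ} (hn0 : n ≠ 0)
    (hσ : σ ∗ gaussianReal 0 t.toNNReal = convPow μ n) :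
    (n + 1) * fisher (σ ∗ μ) t ≤ n * fisher σ t := by
  have hσμ : (σ ∗ μ) ∗ gaussianReal 0 t.toNNReal = convPow μ (n + 1) := by
    rw [convPow, ← hσ, Measure.conv_assoc, Measure.conv_comm μ, ← Measure.conv_assoc]
  set ρ := score (σ ∗ μ) t with hρ
  have hmem : MemLp ρ 2 (convPow μ (n + 1)) := hσμ ▸ memLp_score ht
  have h0 : ∫ x, ρ x ∂(convPow μ (n + 1)) = 0 := hσμ ▸ integral_score ht
  have hdrop := succ_mul_integral_sq_translateAverage_le n hmem h0
  have hJ' : ∫ x, ρ x ^ 2 ∂(convPow μ (n + 1)) = fisher (σ ∗ μ) t := hσμ ▸ integral_sq_score ht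
  have hcross := integral_translateAverage_score_mul (σ := σ) (μ := μ) ht
  have hJ := integral_sq_score (σ := σ) ht
  have hs : MemLp (score σ t) 2 (convPow μ n) := hσ ▸ memLp_score ht
  have hQ : MemLp (translateAverage μ ρ) 2 (convPow μ n) := memLp_translateAverage hmem
  rw [hσ] at hcross hJ
  rw [hJ'] at hdrop
  have hn : (0 : ℝ) < n + 1 := by positivity
  have hpos : 0 ≤ ∫ x, ((n + 1) * translateAverage μ ρ x - n * score σ t x) ^ 2 ∂(convPow μ n) :=
    integral_nonneg fun x => sq_nonneg _
  have e : ∀ x, ((n + 1) * translateAverage μ ρ x - n * score σ t x) ^ 2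
      = (n + 1) ^ 2 * translateAverage μ ρ x ^ 2
        - 2 * (n + 1) * n * (translateAverage μ ρ x * score σ t x)
        + n ^ 2 * score σ t x ^ 2 := fun x => by ring
  simp_rw [e] at hpos
  have i1 : Integrable (fun x => ((n : ℝ) + 1) ^ 2 * translateAverage μ ρ x ^ 2) (convPow μ n) :=
    hQ.integrable_sq.const_mul _
  have i2 : Integrable (fun x => 2 * ((n : ℝ) + 1) * n * (translateAverage μ ρ x * score σ t x))
    (convPow μ n) := (hQ.integrable_mul hs).const_mul _
  have i3 : Integrable (fun x => ((n : ℝ) + 1) ^ 2 * translateAverage μ ρ x ^ 2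
    - 2 * ((n : ℝ) + 1) * n * (translateAverage μ ρ x * score σ t x)) (convPow μ n) := i1.sub i2
  rw [integral_add i3 (hs.integrable_sq.const_mul _), integral_sub i1 i2, integral_const_mul,
    integral_const_mul, integral_const_mul, hcross, hJ] at hpos
  have hn1 : (0 : ℝ) < n := by exact_mod_cast hn0.bot_lt
  have h2 : (n + 1) * ((n + 1) * ∫ x, translateAverage μ ρ x ^ 2 ∂(convPow μ n))
    ≤ (n + 1) * (n * fisher (σ ∗ μ) t) := mul_le_mul_of_nonneg_left hdrop hn.le
  have h3 : 0 ≤ n * (n * fisher σ t - (n + 1) * fisher (σ ∗ μ) t) := by nlinarith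
  have := nonneg_of_mul_nonneg_right h3 hn1
  linarith

lemma heatDx_eq_of_heat_eq {τ : Measure ℝ} [IsProbabilityMeasure τ] {s : ℝ} (ht : 0 < t)
    (hs : 0 < s) (h : heat σ t = heat τ s) : heatDx σ t = heatDx τ s := by
  ext x
  have h1 := hasDerivAt_heat (σ := σ) ht x
  rw [h] at h1
  exact h1.unique (hasDerivAt_heat hs x)

lemma fisher_eq_of_conv_eq {τ : Measure ℝ} [IsProbabilityMeasure τ] {s : ℝ} (ht : 0 < t)
    (hs : 0 < s)
    (h : σ ∗ gaussianReal 0 t.toNNReal = τ ∗ gaussianReal 0 s.toNNReal) :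
    fisher σ t = fisher τ s := by
  have h1 := heat_eq_of_conv_eq ht hs h
  rw [fisher, fisher, h1, heatDx_eq_of_heat_eq ht hs h1]

lemma convPow_conv_gaussianReal (ht : 0 < t) (n : ℕ) :
    convPow (σ ∗ gaussianReal 0 t.toNNReal) n
      = convPow σ n ∗ gaussianReal 0 (n * t).toNNReal := by
  induction n with
  | zero => simp [convPow]
  | succ n ih =>
    have : ((n + 1 : ℕ) * t).toNNReal = (n * t).toNNReal + t.toNNReal := by
      rw [← Real.toNNReal_add (by positivity) ht.le]
      push_cast; ring_nf
    rw [convPow, ih, convPow, this, ← add_zero (0 : ℝ), ← gaussianReal_conv_gaussianReal, add_zero,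
      Measure.conv_assoc, Measure.conv_assoc, ← Measure.conv_assoc (gaussianReal _ _) σ,
      Measure.conv_comm (gaussianReal _ _) σ, Measure.conv_assoc σ]

/-- Monotonicity of the Fisher information of sums of independent identically distributed
variables, before normalization. -/
theorem succ_mul_fisher_convPow_le (ht : 0 < t) {n : ℕ} (hn : 1 ≤ n) :
    (n + 1) * fisher (convPow σ (n + 1)) ((n + 1 : ℕ) * t) ≤ n * fisher (convPow σ n) (n * t) := by
  obtain ⟨k, rfl⟩ : ∃ k, n = k + 1 := ⟨n - 1, by omega⟩
  set μ := σ ∗ gaussianReal 0 t.toNNReal with hμ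
  -- Only one Gaussian factor is split off, so that the sums of `n` and `n + 1` terms are both seen
  -- as heat flows at the same time `t`. The times proportional to the number of terms return at the
  -- end, through equality of the smoothed laws.
  have h1 : (convPow μ k ∗ σ) ∗ gaussianReal 0 t.toNNReal = convPow μ (k + 1) := by
    rw [Measure.conv_assoc, convPow]
  have h2 : ((convPow μ k ∗ σ) ∗ μ) ∗ gaussianReal 0 t.toNNReal = convPow μ (k + 1 + 1) := by
    rw [convPow, ← h1, Measure.conv_assoc _ μ, Measure.conv_comm μ, ← Measure.conv_assoc]
  have h := succ_mul_fisher_conv_le ht k.succ_ne_zero h1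
  rwa [fisher_eq_of_conv_eq ht (by positivity) (h1.trans (convPow_conv_gaussianReal ht _)),
    fisher_eq_of_conv_eq ht (by positivity) (h2.trans (convPow_conv_gaussianReal ht _))] at h

end FisherMonotone

/-! ### Rescaling, and Fisher information of standardized sums. -/

section Scaling

variable {σ : Measure ℝ} {t c : ℝ}

lemma heat_map_div (ht : 0 < t) (hc : 0 < c) (x : ℝ) :
    heat (σ.map (· / c)) t x = c * heat σ (c ^ 2 * t) (c * x) := by
  have hk := continuous_heatKernel t
  unfold heat
  rw [integral_map (by fun_prop) (by fun_prop : Continuous _).aestronglyMeasurable,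
    ← integral_const_mul]
  refine integral_congr_ae (ae_of_all _ fun y => ?_)
  simp only [heatKernel]
  have h1 : √(2 * π * (c ^ 2 * t)) = c * √(2 * π * t) := by
    rw [show 2 * π * (c ^ 2 * t) = c ^ 2 * (2 * π * t) by ring, Real.sqrt_mul (sq_nonneg c),
      Real.sqrt_sq hc.le]
  have h2 : -(c * x - y) ^ 2 / (2 * (c ^ 2 * t)) = -(x - y / c) ^ 2 / (2 * t) := by
    field_simp
  rw [h1, h2, mul_inv, ← mul_assoc, ← mul_assoc, mul_inv_cancel₀ hc.ne', one_mul]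

variable [IsProbabilityMeasure σ]

lemma isProbabilityMeasure_map_div : IsProbabilityMeasure (σ.map (· / c)) :=
  Measure.isProbabilityMeasure_map (by fun_prop)

lemma heatDx_map_div (ht : 0 < t) (hc : 0 < c) (x : ℝ) :
    heatDx (σ.map (· / c)) t x = c ^ 2 * heatDx σ (c ^ 2 * t) (c * x) := by
  have := isProbabilityMeasure_map_div (σ := σ) (c := c)
  have h1 := hasDerivAt_heat (σ := σ.map (· / c)) ht x
  have h2 : HasDerivAt (fun x => c * heat σ (c ^ 2 * t) (c * x))
      (c * (heatDx σ (c ^ 2 * t) (c * x) * c)) x := by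
    have h3 : HasDerivAt (fun x : ℝ => c * x) c x := by
      simpa using (hasDerivAt_id x).const_mul c
    exact ((hasDerivAt_heat (σ := σ) (by positivity) (c * x)).comp x h3).const_mul c
  rw [funext (heat_map_div (σ := σ) ht hc)] at h1
  rw [h1.unique h2]
  ring

lemma fisher_map_div (ht : 0 < t) (hc : 0 < c) :
    fisher (σ.map (· / c)) t = c ^ 2 * fisher σ (c ^ 2 * t) := by
  unfold fisher
  simp_rw [heat_map_div ht hc, heatDx_map_div ht hc]
  have e : ∀ x, (c ^ 2 * heatDx σ (c ^ 2 * t) (c * x)) ^ 2 / (c * heat σ (c ^ 2 * t) (c * x))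
      = c ^ 3 * (heatDx σ (c ^ 2 * t) (c * x) ^ 2 / heat σ (c ^ 2 * t) (c * x)) := by
    intro x
    have := (heat_pos (σ := σ) (show 0 < c ^ 2 * t by positivity) (c * x)).ne'
    field_simp
  simp_rw [e]
  rw [integral_const_mul,
    Measure.integral_comp_mul_left
      (fun x => heatDx σ (c ^ 2 * t) x ^ 2 / heat σ (c ^ 2 * t) x) c,
    abs_of_pos (inv_pos.2 hc), smul_eq_mul]
  field_simp

end Scaling

/-- The law of the standardized sum of `n` independent variables of law `ν`. -/
noncomputable def standardizedLaw (ν : Measure ℝ) (n : ℕ) : Measure ℝ :=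
  (convPow ν n).map (· / √(n : ℝ))

instance isProbabilityMeasure_standardizedLaw (ν : Measure ℝ) [IsProbabilityMeasure ν] (n : ℕ) :
    IsProbabilityMeasure (standardizedLaw ν n) :=
  isProbabilityMeasure_map_div

/-- Monotonicity of the Fisher information along the central limit theorem. -/
theorem fisher_standardizedLaw_anti {ν : Measure ℝ} [IsProbabilityMeasure ν] {t : ℝ} (ht : 0 < t)
    {m n : ℕ} (hm : 1 ≤ m) (hmn : m ≤ n) :
    fisher (standardizedLaw ν n) t ≤ fisher (standardizedLaw ν m) t := by
  -- Smoothing the standardized law for time `t` corresponds to smoothing each of the `n` summands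
  -- for time `t`; this supplies the normalizing factor `n`.
  have e : ∀ n : ℕ, 1 ≤ n → fisher (standardizedLaw ν n) t = n * fisher (convPow ν n) (n * t) := by
    intro n hn
    have hn' : (0 : ℝ) < n := by exact_mod_cast hn
    rw [standardizedLaw, fisher_map_div ht (Real.sqrt_pos.2 hn'), Real.sq_sqrt hn'.le]
  induction n, hmn using Nat.le_induction with
  | base => exact le_rfl
  | succ n hmn ih =>
    refine le_trans ?_ ih
    rw [e _ (by omega), e _ (by omega)]
    have := succ_mul_fisher_convPow_le (σ := ν) ht (hm.trans hmn)
    push_cast at this ⊢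
    exact this

/-! ### From Fisher information to entropy. -/

section EntropyComparison

/-- Gibbs' inequality, pointwise. -/
lemma negMulLog_le_gibbs {p q : ℝ} (hp : 0 ≤ p) (hq : 0 < q) :
    negMulLog p ≤ p * -log q + q - p := by
  rcases hp.eq_or_lt with rfl | hp
  · simpa using hq.le
  · have h := Real.log_le_sub_one_of_pos (div_pos hq hp)
    rw [log_div hq.ne' hp.ne'] at h
    have h2 : p * (log q - log p) ≤ p * (q / p - 1) := by gcongr
    have h3 : p * (q / p - 1) = q - p := by field_simp
    rw [negMulLog]
    linarith

/-- Averaging the translates of a probability density increases its entropy. -/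
lemma integral_negMulLog_le_of_average {τ : Measure ℝ} [IsProbabilityMeasure τ] {φ p : ℝ → ℝ}
    (hφm : Measurable φ) (hφ0 : ∀ x, 0 ≤ φ x) (hφ : Integrable φ)
    (hφl : Integrable fun x => negMulLog (φ x)) (hp : ∀ᵐ x, p x = ∫ y, φ (x - y) ∂τ)
    (hpl : Integrable fun x => negMulLog (p x)) :
    ∫ x, negMulLog (φ x) ≤ ∫ x, negMulLog (p x) := by
  have hlm : Measurable fun x => negMulLog (φ x) := continuous_negMulLog.measurable.comp hφm
  -- Translation invariance rewrites the left side as an average over translates, so that Jensen for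
  -- the concave `negMulLog` can be used pointwise in `x`.
  rw [← integral_integral_comp_sub (σ := τ) hlm hφl]
  refine integral_mono_ae (integrable_integral_comp_sub hlm hφl) hpl ?_
  filter_upwards [hp, (integrable_prod_comp_sub (σ := τ) hφm hφ).prod_right_ae,
    (integrable_prod_comp_sub (σ := τ) hlm hφl).prod_right_ae] with x hx h1 h2
  rw [hx]
  exact concaveOn_negMulLog.le_map_integral continuous_negMulLog.continuousOn isClosed_Ici
    (ae_of_all _ fun y => hφ0 (x - y)) h1 h2

variable {σ τ : Measure ℝ} [IsProbabilityMeasure σ] [IsProbabilityMeasure τ] {t : ℝ}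

lemma integral_negMulLog_heatKernel (ht : 0 < t) :
    Integrable (fun x => negMulLog (heatKernel t x)) ∧
      ∫ x, negMulLog (heatKernel t x) = log (2 * π * t) / 2 + 1 / 2 := by
  have e : ∀ x, negMulLog (heatKernel t x)
      = log (2 * π * t) / 2 * heatKernel t x + (x ^ 2 * heatKernel t x) / (2 * t) := by
    intro x
    rw [negMulLog, log_heatKernel ht]; ring
  have h := integral_sq_heatKernel_sub ht 0
  simp only [sub_zero] at h
  simp_rw [e]
  refine ⟨((integrable_heatKernel ht).const_mul _).add (h.1.div_const _), ?_⟩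
  rw [integral_add ((integrable_heatKernel ht).const_mul _) (h.1.div_const _), integral_const_mul,
    integral_div, h.2, integral_heatKernel ht]
  field_simp
  ring

/-- The smoothed density is an average of translates of the kernel, so the Gaussian entropy is a
lower bound. -/
lemma le_heatEntropy (ht : 0 < t) (hσ : Integrable (fun y => y ^ 2) σ) :
    log (2 * π * t) / 2 + 1 / 2 ≤ heatEntropy σ t := by
  rw [← (integral_negMulLog_heatKernel ht).2]
  exact integral_negMulLog_le_of_average (continuous_heatKernel t).measurable
    (fun x => (heatKernel_pos ht x).le) (integrable_heatKernel ht)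
    (integral_negMulLog_heatKernel ht).1 (ae_of_all _ fun x => rfl)
    (integrable_negMulLog_heat ht hσ)

/-- The cross entropy of the heat flow relative to a Gaussian law. -/
lemma integral_gibbs_heat {s : ℝ} (ht : 0 < t) (hs : 0 < s)
    (hσ : Integrable (fun y => y ^ 2) σ) :
    Integrable (fun x => heat σ t x * -log (heatKernel s x) + heatKernel s x - heat σ t x) ∧
      ∫ x, (heat σ t x * -log (heatKernel s x) + heatKernel s x - heat σ t x)
        = log (2 * π * s) / 2 + ((∫ y, y ^ 2 ∂σ) + t) / (2 * s) := by
  have e : ∀ x, heat σ t x * -log (heatKernel s x) + heatKernel s x - heat σ t x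
      = log (2 * π * s) / 2 * heat σ t x + (x ^ 2 * heat σ t x) / (2 * s) + heatKernel s x
        - heat σ t x := by
    intro x
    rw [log_heatKernel hs]; ring
  simp_rw [e]
  obtain ⟨h1, h2⟩ := integral_sq_heat ht hσ
  have h3 := integrable_heat (σ := σ) ht
  have i1 : Integrable fun x => log (2 * π * s) / 2 * heat σ t x + (x ^ 2 * heat σ t x) / (2 * s) :=
    (h3.const_mul _).add (h1.div_const _)
  have i2 : Integrable fun x => log (2 * π * s) / 2 * heat σ t x + (x ^ 2 * heat σ t x) / (2 * s)
    + heatKernel s x := i1.add (integrable_heatKernel hs)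
  refine ⟨i2.sub h3, ?_⟩
  rw [integral_sub i2 h3, integral_add i1 (integrable_heatKernel hs),
    integral_add (h3.const_mul _) (h1.div_const _), integral_const_mul, integral_div, h2,
    integral_heat ht, integral_heatKernel hs]
  ring

/-- Gibbs' inequality against the Gaussian of variance `t`. This reference makes the gap to the
lower bound of `le_heatEntropy` equal to half the second moment of `σ` divided by `t`. -/
lemma heatEntropy_le (ht : 0 < t) (hσ : Integrable (fun y => y ^ 2) σ) :
    heatEntropy σ t ≤ log (2 * π * t) / 2 + ((∫ y, y ^ 2 ∂σ) + t) / (2 * t) := by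
  rw [← (integral_gibbs_heat ht ht hσ).2]
  exact integral_mono (integrable_negMulLog_heat ht hσ) (integral_gibbs_heat ht ht hσ).1
    fun x => negMulLog_le_gibbs (heat_pos ht x).le (heatKernel_pos ht x)

/-- A comparison of Fisher informations along the heat flow yields a comparison of entropies. -/
theorem heatEntropy_le_of_fisher_le (hσ : Integrable (fun y => y ^ 2) σ)
    (hτ : Integrable (fun y => y ^ 2) τ) (h : ∀ t, 0 < t → fisher τ t ≤ fisher σ t) (ht : 0 < t) :
    heatEntropy σ t ≤ heatEntropy τ t := by
  set D : ℝ → ℝ := fun t => heatEntropy τ t - heatEntropy σ t with hD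
  have hd : ∀ s, 0 < s → HasDerivAt D (fisher τ s / 2 - fisher σ s / 2) s := fun s hs =>
    (hasDerivAt_heatEntropy hs hτ).sub (hasDerivAt_heatEntropy hs hσ)
  have hanti : AntitoneOn D (Ioi 0) := by
    refine antitoneOn_of_deriv_nonpos (convex_Ioi 0)
      (fun s hs => (hd s hs).continuousAt.continuousWithinAt) ?_ ?_
    · rw [interior_Ioi]
      exact fun s hs => (hd s hs).differentiableAt.differentiableWithinAt
    · rw [interior_Ioi]
      intro s hs
      rw [(hd s hs).deriv]
      linarith [h s hs]
  set m := ∫ y, y ^ 2 ∂σ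
  -- The logarithms in the two Gaussian bounds cancel. An antitone function with a lower bound
  -- tending to zero at infinity is nonnegative.
  have hlow : ∀ s, 0 < s → -(m / 2) * s⁻¹ ≤ D s := by
    intro s hs
    have h1 := le_heatEntropy hs hτ
    have h2 := heatEntropy_le hs hσ
    have h3 : (m + s) / (2 * s) = m / 2 * s⁻¹ + 1 / 2 := by field_simp
    simp only [hD]
    linarith
  have hlim : Tendsto (fun s : ℝ => -(m / 2) * s⁻¹) atTop (𝓝 0) := by
    simpa using tendsto_inv_atTop_zero.const_mul (-(m / 2))
  have h0 : 0 ≤ D t := by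
    refine le_of_tendsto hlim ?_
    filter_upwards [eventually_ge_atTop t] with s hs
    exact (hlow s (ht.trans_le hs)).trans (hanti ht (ht.trans_le hs) hs)
  exact sub_nonneg.1 h0

end EntropyComparison

/-! ### The heat flow as the time tends to zero. -/

section SmallTime

lemma lintegral_enorm_comp_sub (f : ℝ → ℝ) (z : ℝ) : ∫⁻ x, ‖f (x - z)‖ₑ = ∫⁻ x, ‖f x‖ₑ :=
  lintegral_sub_right_eq_self (fun x => ‖f x‖ₑ) z

/-- Continuity of translations in `L¹`. -/
lemma tendsto_lintegral_translate_sub {f : ℝ → ℝ} (hf : Integrable f) :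
    Tendsto (fun z => ∫⁻ x, ‖f (x - z) - f x‖ₑ) (𝓝 0) (𝓝 0) := by
  have hfm : MemLp f 1 volume := memLp_one_iff_integrable.2 hf
  let g : C(ℝ, C(ℝ, ℝ)) := ContinuousMap.curry ⟨fun p : ℝ × ℝ => p.2 - p.1, by fun_prop⟩
  have hg : ∀ z, MeasurePreserving (g z) volume volume := fun z => measurePreserving_sub_right _ z
  have hcont : Continuous fun z => Lp.compMeasurePreserving (g z) (hg z) (hfm.toLp f) :=
    continuous_const.compMeasurePreservingLp g.continuous hg (by simp)
  have h := tendsto_iff_edist_tendsto_0.1 (hcont.tendsto 0)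
  refine h.congr fun z => ?_
  rw [Lp.toLp_compMeasurePreserving, Lp.toLp_compMeasurePreserving, Lp.edist_toLp_toLp,
    eLpNorm_one_eq_lintegral_enorm]
  refine lintegral_congr fun x => ?_
  simp [g]

variable {σ : Measure ℝ} [IsProbabilityMeasure σ] {f : ℝ → ℝ}

/-- Commutativity of convolution exchanges the roles: translates of `f` are averaged over a
Gaussian, instead of translates of the kernel over `σ`. -/
lemma heat_ae_eq_integral_comp_sub (hfm : Measurable f) (hf0 : ∀ x, 0 ≤ f x) (hf : Integrable f)
    (hσ : σ = volume.withDensity fun x => ENNReal.ofReal (f x)) {t : ℝ} (ht : 0 < t) :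
    ∀ᵐ x, heat σ t x = ∫ z, f (x - z) ∂(gaussianReal 0 t.toNNReal) := by
  have hsf : SFinite (volume.withDensity fun x => ENNReal.ofReal (f x)) := hσ ▸ inferInstance
  have h1 := conv_gaussianReal (σ := σ) ht
  have h2 : gaussianReal 0 t.toNNReal ∗ σ = volume.withDensity
      fun x => ∫⁻ z, ENNReal.ofReal (f (x - z)) ∂(gaussianReal 0 t.toNNReal) := by
    rw [hσ]
    exact conv_withDensity hfm.ennreal_ofReal
  rw [Measure.conv_comm, h2, withDensity_eq_iff_of_sigmaFinite] at h1
  · filter_upwards [h1, (integrable_prod_comp_sub (σ := gaussianReal 0 t.toNNReal)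
      hfm hf).prod_right_ae] with x hx hi
    rw [← ofReal_integral_eq_lintegral_ofReal hi (ae_of_all _ fun z => hf0 _),
      ENNReal.ofReal_eq_ofReal_iff (integral_nonneg fun z => hf0 _) (heat_pos ht x).le] at hx
    exact hx.symm
  · exact (Measurable.lintegral_prod_right (f := fun x z : ℝ => ENNReal.ofReal (f (x - z)))
      (by fun_prop)).aemeasurable
  · exact (continuous_heat ht).measurable.ennreal_ofReal.aemeasurable

lemma lintegral_heat_sub_le (hfm : Measurable f) (hf0 : ∀ x, 0 ≤ f x) (hf : Integrable f)
    (hσ : σ = volume.withDensity fun x => ENNReal.ofReal (f x)) {t : ℝ} (ht : 0 < t) :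
    ∫⁻ x, ‖heat σ t x - f x‖ₑ
      ≤ ∫⁻ z, (∫⁻ x, ‖f (x - z) - f x‖ₑ) ∂(gaussianReal 0 t.toNNReal) := by
  rw [lintegral_lintegral_swap (f := fun z x => ‖f (x - z) - f x‖ₑ) (by fun_prop)]
  refine lintegral_mono_ae ?_
  filter_upwards [heat_ae_eq_integral_comp_sub hfm hf0 hf hσ ht,
    (integrable_prod_comp_sub (σ := gaussianReal 0 t.toNNReal) hfm hf).prod_right_ae] with x hx hi
  have : heat σ t x - f x = ∫ z, (f (x - z) - f x) ∂(gaussianReal 0 t.toNNReal) := by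
    rw [integral_sub hi (integrable_const _), hx]
    simp
  rw [this]
  exact enorm_integral_le_lintegral_enorm _

lemma tendsto_lintegral_heat_sub (hfm : Measurable f) (hf0 : ∀ x, 0 ≤ f x) (hf : Integrable f)
    (hσ : σ = volume.withDensity fun x => ENNReal.ofReal (f x)) {c : ℕ → ℝ}
    (hc : ∀ j, 0 < c j) (hc0 : Tendsto c atTop (𝓝 0)) :
    Tendsto (fun j => ∫⁻ x, ‖heat σ (c j ^ 2) x - f x‖ₑ) atTop (𝓝 0) := by
  set ω : ℝ → ENNReal := fun z => ∫⁻ x, ‖f (x - z) - f x‖ₑ with hω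
  have hωm : Measurable ω := by
    refine Measurable.lintegral_prod_right (f := fun z x : ℝ => ‖f (x - z) - f x‖ₑ) ?_
    fun_prop
  have hωb : ∀ z, ω z ≤ (∫⁻ x, ‖f x‖ₑ) + ∫⁻ x, ‖f x‖ₑ := by
    intro z
    calc ω z ≤ ∫⁻ x, (‖f (x - z)‖ₑ + ‖f x‖ₑ) := lintegral_mono fun x => enorm_sub_le
      _ = _ := by
        rw [lintegral_add_right _ (by fun_prop), lintegral_enorm_comp_sub]
  -- Writing the variance as a square turns the moving Gaussian into a dilation of a fixed one,
  -- against which dominated convergence applies.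
  have hlaw : ∀ j, gaussianReal 0 (c j ^ 2).toNNReal = (gaussianReal 0 1).map (c j * ·) := by
    intro j
    rw [gaussianReal_map_const_mul, mul_zero, mul_one]
    congr 1
    ext
    simp [sq_nonneg]
  have hlim : Tendsto (fun j => ∫⁻ u, ω (c j * u) ∂(gaussianReal 0 1)) atTop (𝓝 0) := by
    have := tendsto_lintegral_of_dominated_convergence (μ := gaussianReal 0 1)
      (F := fun j u => ω (c j * u)) (f := fun _ => 0)
      (fun _ => (∫⁻ x, ‖f x‖ₑ) + ∫⁻ x, ‖f x‖ₑ) (fun j => by fun_prop)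
      (fun j => ae_of_all _ fun u => hωb _)
      (by
        rw [lintegral_const, measure_univ, mul_one]
        exact ENNReal.add_ne_top.2 ⟨hf.2.ne, hf.2.ne⟩)
      (ae_of_all _ fun u => ?_)
    · simpa using this
    · have h0 : Tendsto (fun j => c j * u) atTop (𝓝 0) := by simpa using hc0.mul_const u
      exact (tendsto_lintegral_translate_sub hf).comp h0
  refine tendsto_of_tendsto_of_tendsto_of_le_of_le tendsto_const_nhds hlim (fun _ => zero_le)
    fun j => ?_
  refine (lintegral_heat_sub_le hfm hf0 hf hσ (pow_pos (hc j) 2)).trans_eq ?_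
  rw [hlaw, lintegral_map hωm (by fun_prop)]

/-- Along a sequence of times decreasing to zero, the heat flow converges almost everywhere to the
initial density. -/
lemma exists_seq_tendsto_heat (hfm : Measurable f) (hf0 : ∀ x, 0 ≤ f x) (hf : Integrable f)
    (hσ : σ = volume.withDensity fun x => ENNReal.ofReal (f x)) :
    ∃ t : ℕ → ℝ, (∀ j, 0 < t j) ∧ Tendsto t atTop (𝓝 0) ∧
      ∀ᵐ x, Tendsto (fun j => heat σ (t j) x) atTop (𝓝 (f x)) := by
  set c : ℕ → ℝ := fun j => 1 / ((j : ℝ) + 1) with hc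
  have hcp : ∀ j, 0 < c j := fun j => by positivity
  have hc0 : Tendsto c atTop (𝓝 0) := tendsto_one_div_add_atTop_nhds_zero_nat
  have hmeas : TendstoInMeasure volume (fun j => heat σ (c j ^ 2)) atTop f := by
    refine tendstoInMeasure_of_tendsto_eLpNorm (p := 1) one_ne_zero
      (fun j => (continuous_heat (pow_pos (hcp j) 2)).aestronglyMeasurable)
      hfm.aestronglyMeasurable ?_
    simp_rw [eLpNorm_one_eq_lintegral_enorm]
    exact tendsto_lintegral_heat_sub hfm hf0 hf hσ hcp hc0
  obtain ⟨ns, hns, hae⟩ := hmeas.exists_seq_tendsto_ae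
  refine ⟨fun j => c (ns j) ^ 2, fun j => pow_pos (hcp _) 2, ?_, hae⟩
  simpa using (hc0.comp hns.tendsto_atTop).pow 2

lemma integral_negMulLog_le_heatEntropy (hfm : Measurable f) (hf0 : ∀ x, 0 ≤ f x)
    (hf : Integrable f) (hσ : σ = volume.withDensity fun x => ENNReal.ofReal (f x))
    (hσ2 : Integrable (fun y => y ^ 2) σ) (hfl : Integrable fun x => negMulLog (f x)) {t : ℝ}
    (ht : 0 < t) : ∫ x, negMulLog (f x) ≤ heatEntropy σ t :=
  integral_negMulLog_le_of_average hfm hf0 hf hfl (heat_ae_eq_integral_comp_sub hfm hf0 hf hσ ht)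
    (integrable_negMulLog_heat ht hσ2)

/-- The cross entropy of a density relative to the standard Gaussian law. -/
lemma integral_gibbs (hfm : Measurable f) (hf0 : ∀ x, 0 ≤ f x) (hf : Integrable f)
    (hσ : σ = volume.withDensity fun x => ENNReal.ofReal (f x))
    (hσ2 : Integrable (fun y => y ^ 2) σ) :
    Integrable (fun x => f x * -log (heatKernel 1 x) + heatKernel 1 x - f x) ∧
      ∫ x, (f x * -log (heatKernel 1 x) + heatKernel 1 x - f x)
        = log (2 * π) / 2 + (∫ y, y ^ 2 ∂σ) / 2 := by
  have e : ∀ x, f x * -log (heatKernel 1 x) + heatKernel 1 x - f x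
      = log (2 * π) / 2 * f x + (x ^ 2 * f x) / 2 + heatKernel 1 x - f x := by
    intro x
    rw [log_heatKernel one_pos]; ring_nf
  simp_rw [e]
  have h1 : Integrable fun x => x ^ 2 * f x := by
    rw [hσ, integrable_withDensity_iff hfm.ennreal_ofReal
      (ae_of_all _ fun x => ENNReal.ofReal_lt_top)] at hσ2
    simpa only [ENNReal.toReal_ofReal (hf0 _)] using hσ2
  have h2 : ∫ y, y ^ 2 ∂σ = ∫ x, x ^ 2 * f x := by
    rw [hσ, integral_withDensity_eq_integral_toReal_smul hfm.ennreal_ofReal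
      (ae_of_all _ fun x => ENNReal.ofReal_lt_top)]
    simp_rw [ENNReal.toReal_ofReal (hf0 _), smul_eq_mul, mul_comm]
  have h3 : ∫ x, f x = 1 := by
    have := integral_withDensity_eq_integral_toReal_smul (μ := volume) hfm.ennreal_ofReal
      (ae_of_all _ fun x => ENNReal.ofReal_lt_top) (fun _ => (1 : ℝ))
    rw [← hσ] at this
    simpa [ENNReal.toReal_ofReal (hf0 _)] using this.symm
  have i1 : Integrable fun x => log (2 * π) / 2 * f x + (x ^ 2 * f x) / 2 :=
    (hf.const_mul _).add (h1.div_const _)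
  have i2 : Integrable fun x => log (2 * π) / 2 * f x + (x ^ 2 * f x) / 2 + heatKernel 1 x :=
    i1.add (integrable_heatKernel one_pos)
  refine ⟨i2.sub hf, ?_⟩
  rw [integral_sub i2 hf, integral_add i1 (integrable_heatKernel one_pos),
    integral_add (hf.const_mul _) (h1.div_const _), integral_const_mul, integral_div, ← h2, h3,
    integral_heatKernel one_pos]
  ring

/-- Upper semicontinuity of the entropy along the heat flow as the time tends to zero. -/
lemma le_integral_negMulLog (hfm : Measurable f) (hf0 : ∀ x, 0 ≤ f x) (hf : Integrable f)
    (hσ : σ = volume.withDensity fun x => ENNReal.ofReal (f x))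
    (hσ2 : Integrable (fun y => y ^ 2) σ) {H : ℝ} (hH : ∀ t, 0 < t → H ≤ heatEntropy σ t) :
    Integrable (fun x => negMulLog (f x)) ∧ H ≤ ∫ x, negMulLog (f x) := by
  obtain ⟨t, ht, ht0, hae⟩ := exists_seq_tendsto_heat hfm hf0 hf hσ
  set m := ∫ y, y ^ 2 ∂σ
  -- The deficit in Gibbs' inequality against the standard Gaussian. It is nonnegative, so Fatou
  -- applies, and it differs from minus the entropy density only by terms whose integrals converge,
  -- being governed by mass and second moment.
  set k : ℝ → ℝ → ℝ := fun p x => p * -log (heatKernel 1 x) + heatKernel 1 x - p - negMulLog p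
    with hk
  have hk0 : ∀ p x, 0 ≤ p → 0 ≤ k p x := fun p x hp =>
    sub_nonneg.2 (negMulLog_le_gibbs hp (heatKernel_pos one_pos x))
  have hkc : ∀ x, Continuous fun p => k p x := fun x => by
    have := continuous_negMulLog
    simp only [hk]; fun_prop
  have hlogc : Continuous fun x => log (heatKernel 1 x) :=
    (continuous_heatKernel 1).log fun x => (heatKernel_pos one_pos x).ne'
  have hKc := continuous_heatKernel 1
  have hnml := continuous_negMulLog
  have hint : ∀ j, Integrable (fun x => k (heat σ (t j) x) x) ∧
      ∫ x, k (heat σ (t j) x) x ≤ log (2 * π) / 2 + (m + t j) / 2 - H := by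
    intro j
    obtain ⟨i1, e1⟩ := integral_gibbs_heat (ht j) one_pos hσ2
    have i2 := integrable_negMulLog_heat (ht j) hσ2
    refine ⟨i1.sub i2, ?_⟩
    simp only [hk]
    rw [integral_sub i1 i2, e1, mul_one, mul_one]
    have := hH _ (ht j)
    rw [heatEntropy] at this
    linarith
  have hkf : Measurable fun x => k (f x) x := by
    have := hnml.measurable.comp hfm
    simp only [Function.comp_def] at this
    have := hlogc.measurable
    have := hKc.measurable
    simp only [hk]; fun_prop
  have hfatou : ∫⁻ x, ENNReal.ofReal (k (f x) x)
      ≤ ENNReal.ofReal (log (2 * π) / 2 + m / 2 - H) := by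
    have hlim : Tendsto (fun j => ENNReal.ofReal (log (2 * π) / 2 + (m + t j) / 2 - H)) atTop
        (𝓝 (ENNReal.ofReal (log (2 * π) / 2 + m / 2 - H))) := by
      refine ENNReal.tendsto_ofReal ?_
      have := ((((ht0.const_add m).div_const 2).const_add (log (2 * π) / 2)).sub_const H)
      simpa using this
    calc ∫⁻ x, ENNReal.ofReal (k (f x) x)
        ≤ ∫⁻ x, liminf (fun j => ENNReal.ofReal (k (heat σ (t j) x) x)) atTop := by
          refine lintegral_mono_ae ?_
          filter_upwards [hae] with x hx
          exact (ENNReal.tendsto_ofReal (((hkc x).tendsto _).comp hx)).liminf_eq.ge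
      _ ≤ liminf (fun j => ∫⁻ x, ENNReal.ofReal (k (heat σ (t j) x) x)) atTop := by
          refine lintegral_liminf_le fun j => ?_
          have hc := continuous_heat (σ := σ) (ht j)
          exact ((((hc.mul hlogc.neg).add hKc).sub hc).sub
            (hnml.comp hc)).measurable.ennreal_ofReal
      _ ≤ liminf (fun j => ENNReal.ofReal (log (2 * π) / 2 + (m + t j) / 2 - H)) atTop := by
          refine liminf_le_liminf (Eventually.of_forall fun j => ?_)
          rw [← ofReal_integral_eq_lintegral_ofReal (hint j).1
            (ae_of_all _ fun x => hk0 _ _ (heat_pos (ht j) x).le)]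
          exact ENNReal.ofReal_le_ofReal (hint j).2
      _ = _ := hlim.liminf_eq
  -- `ENNReal.ofReal` truncates at zero, so the Fatou bound yields a real inequality only once its
  -- right side is known to be nonnegative.
  have hB : 0 ≤ log (2 * π) / 2 + m / 2 - H := by
    have hlim : Tendsto (fun j => log (2 * π) / 2 + (m + t j) / 2 - H) atTop
        (𝓝 (log (2 * π) / 2 + m / 2 - H)) := by
      have := ((((ht0.const_add m).div_const 2).const_add (log (2 * π) / 2)).sub_const H)
      simpa using this
    exact ge_of_tendsto' hlim fun j =>
      (integral_nonneg fun x => hk0 _ _ (heat_pos (ht j) x).le).trans (hint j).2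
  have hknn : 0 ≤ᵐ[volume] fun x => k (f x) x := ae_of_all _ fun x => hk0 _ _ (hf0 x)
  have hkint : Integrable fun x => k (f x) x :=
    ⟨hkf.aestronglyMeasurable, (hasFiniteIntegral_iff_ofReal hknn).2
      (hfatou.trans_lt ENNReal.ofReal_lt_top)⟩
  have hkle : ∫ x, k (f x) x ≤ log (2 * π) / 2 + m / 2 - H := by
    rw [← ofReal_integral_eq_lintegral_ofReal hkint hknn] at hfatou
    exact (ENNReal.ofReal_le_ofReal_iff hB).1 hfatou
  obtain ⟨i1, e1⟩ := integral_gibbs hfm hf0 hf hσ hσ2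
  have e : ∀ x, negMulLog (f x)
      = (f x * -log (heatKernel 1 x) + heatKernel 1 x - f x) - k (f x) x := fun x => by
    simp only [hk]; ring
  simp_rw [e]
  refine ⟨i1.sub hkint, ?_⟩
  rw [integral_sub i1 hkint, e1]
  linarith

/-- The second moment makes the Gaussian cross entropy finite, and Gibbs' inequality dominates by
it. This excludes entropy `+∞`. -/
lemma lintegral_negMulLog_lt_top (hfm : Measurable f) (hf0 : ∀ x, 0 ≤ f x) (hf : Integrable f)
    (hσ : σ = volume.withDensity fun x => ENNReal.ofReal (f x))
    (hσ2 : Integrable (fun y => y ^ 2) σ) : ∫⁻ x, ENNReal.ofReal (negMulLog (f x)) < ⊤ := by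
  have h := (integral_gibbs hfm hf0 hf hσ hσ2).1
  refine (lintegral_mono fun x => ?_).trans_lt h.2
  refine (ENNReal.ofReal_le_ofReal
    (negMulLog_le_gibbs (hf0 x) (heatKernel_pos one_pos x))).trans ?_
  exact Real.ofReal_le_enorm _

end SmallTime

/-! ### Entropy of random variables through their densities. -/

variable {Ω : Type*} [MeasurableSpace Ω] {P : Measure Ω}

section Density

variable {Y : Ω → ℝ}

/-- The Lebesgue density of a real random variable, with real values. -/
noncomputable def realPDF (P : Measure Ω) (Y : Ω → ℝ) (x : ℝ) : ℝ := (pdf Y P volume x).toReal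

lemma measurable_realPDF : Measurable (realPDF P Y) := (measurable_pdf Y P volume).ennreal_toReal

lemma realPDF_nonneg (x : ℝ) : 0 ≤ realPDF P Y x := ENNReal.toReal_nonneg

lemma integrable_sq_map (hY2 : MemLp Y 2 P) : Integrable (fun y => y ^ 2) (P.map Y) := by
  rw [integrable_map_measure (by fun_prop) hY2.1.aemeasurable]
  exact hY2.integrable_sq

variable [IsProbabilityMeasure P]

lemma map_eq_withDensity_realPDF (hY : HasPDF Y P volume) :
    P.map Y = volume.withDensity fun x => ENNReal.ofReal (realPDF P Y x) := by
  rw [map_eq_withDensity_pdf Y P volume]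
  exact withDensity_congr_ae pdf.ofReal_toReal_ae_eq.symm

lemma integrable_realPDF : Integrable (realPDF P Y) := by
  refine integrable_toReal_of_lintegral_ne_top (measurable_pdf Y P volume).aemeasurable ?_
  have := withDensity_pdf_le_map Y P volume univ
  rw [withDensity_apply _ MeasurableSet.univ, Measure.restrict_univ] at this
  exact (this.trans_lt (measure_lt_top _ _)).ne

lemma lintegral_comp_logDensity (hY : HasPDF Y P volume) {φ : ℝ → ENNReal} (hφ : Measurable φ) :
    ∫⁻ ω, φ (logDensity P Y ω) ∂P
      = ∫⁻ x, ENNReal.ofReal (realPDF P Y x) * φ (log (realPDF P Y x)) := by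
  have hm := measurable_realPDF (P := P) (Y := Y)
  have hm2 : Measurable fun x => φ (log (realPDF P Y x)) := hφ.comp (measurable_log.comp hm)
  have : ∫⁻ ω, φ (logDensity P Y ω) ∂P = ∫⁻ x, φ (log (realPDF P Y x)) ∂(P.map Y) :=
    (lintegral_map' hm2.aemeasurable (HasPDF.aemeasurable Y P volume)).symm
  rw [this, map_eq_withDensity_realPDF hY,
    lintegral_withDensity_eq_lintegral_mul _ hm.ennreal_ofReal hm2]
  rfl

lemma lintegral_neg_logDensity (hY : HasPDF Y P volume) :
    ∫⁻ ω, ENNReal.ofReal (-logDensity P Y ω) ∂P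
      = ∫⁻ x, ENNReal.ofReal (negMulLog (realPDF P Y x)) := by
  rw [lintegral_comp_logDensity hY (φ := fun u => ENNReal.ofReal (-u)) (by fun_prop)]
  refine lintegral_congr fun x => ?_
  rw [← ENNReal.ofReal_mul (realPDF_nonneg x), negMulLog]
  ring_nf

lemma lintegral_logDensity (hY : HasPDF Y P volume) :
    ∫⁻ ω, ENNReal.ofReal (logDensity P Y ω) ∂P
      = ∫⁻ x, ENNReal.ofReal (-negMulLog (realPDF P Y x)) := by
  rw [lintegral_comp_logDensity hY (φ := fun u => ENNReal.ofReal u) (by fun_prop)]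
  refine lintegral_congr fun x => ?_
  rw [← ENNReal.ofReal_mul (realPDF_nonneg x), negMulLog]
  ring_nf

lemma isProbabilityMeasure_map (hY : HasPDF Y P volume) : IsProbabilityMeasure (P.map Y) :=
  Measure.isProbabilityMeasure_map (HasPDF.aemeasurable Y P volume)

lemma lintegral_negMulLog_realPDF_lt_top (hY : HasPDF Y P volume) (hY2 : MemLp Y 2 P) :
    ∫⁻ x, ENNReal.ofReal (negMulLog (realPDF P Y x)) < ⊤ := by
  have := isProbabilityMeasure_map hY
  exact lintegral_negMulLog_lt_top measurable_realPDF realPDF_nonneg integrable_realPDF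
    (map_eq_withDensity_realPDF hY) (integrable_sq_map hY2)

lemma hasEntropy_of_memLp (hY : HasPDF Y P volume) (hY2 : MemLp Y 2 P) : HasEntropy P Y :=
  ⟨hY, (lintegral_neg_logDensity hY).trans_lt (lintegral_negMulLog_realPDF_lt_top hY hY2)⟩

lemma entropy_eq_integral (hY : HasPDF Y P volume)
    (hi : Integrable fun x => negMulLog (realPDF P Y x)) :
    entropy P Y = ((∫ x, negMulLog (realPDF P Y x) : ℝ) : EReal) := by
  rw [entropy, lintegral_neg_logDensity hY, lintegral_logDensity hY,
    integral_eq_lintegral_pos_part_sub_lintegral_neg_part hi]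
  have h1 : ∫⁻ x, ENNReal.ofReal (negMulLog (realPDF P Y x)) ≠ ⊤ := hi.lintegral_lt_top.ne
  have h2 : ∫⁻ x, ENNReal.ofReal (-negMulLog (realPDF P Y x)) ≠ ⊤ := hi.neg.lintegral_lt_top.ne
  rw [EReal.coe_sub, EReal.coe_ennreal_toReal h1, EReal.coe_ennreal_toReal h2]

/-- The positive part always has finite integral, so failure of integrability can only come from an
infinite negative part. -/
lemma entropy_eq_bot (hY : HasPDF Y P volume) (hY2 : MemLp Y 2 P)
    (hi : ¬ Integrable fun x => negMulLog (realPDF P Y x)) : entropy P Y = ⊥ := by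
  have hm : Measurable fun x => negMulLog (realPDF P Y x) :=
    continuous_negMulLog.measurable.comp measurable_realPDF
  have h1 := lintegral_negMulLog_realPDF_lt_top hY hY2
  have h2 : ∫⁻ x, ENNReal.ofReal (-negMulLog (realPDF P Y x)) = ⊤ := by
    by_contra h2
    refine hi ⟨hm.aestronglyMeasurable, ?_⟩
    have e : ∀ u : ℝ, ‖u‖ₑ ≤ ENNReal.ofReal u + ENNReal.ofReal (-u) := by
      intro u
      rw [Real.enorm_eq_ofReal_abs]
      rcases abs_cases u with ⟨h, -⟩ | ⟨h, -⟩ <;> rw [h]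
      · exact le_self_add
      · exact le_add_self
    refine (lintegral_mono fun x => e _).trans_lt ?_
    rw [lintegral_add_left hm.ennreal_ofReal]
    exact ENNReal.add_lt_top.2 ⟨h1, lt_top_iff_ne_top.2 h2⟩
  rw [entropy, lintegral_neg_logDensity hY, lintegral_logDensity hY, h2, EReal.coe_ennreal_top,
    EReal.sub_top]

/-- A comparison of Fisher informations along the heat flow yields a comparison of differential
entropies. -/
theorem entropy_le_of_fisher_le {Y Z : Ω → ℝ} (hY : HasPDF Y P volume) (hY2 : MemLp Y 2 P)
    (hZ : HasPDF Z P volume) (hZ2 : MemLp Z 2 P)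
    (h : ∀ t, 0 < t → fisher (P.map Z) t ≤ fisher (P.map Y) t) : entropy P Y ≤ entropy P Z := by
  have := isProbabilityMeasure_map hY
  have := isProbabilityMeasure_map hZ
  by_cases hi : Integrable fun x => negMulLog (realPDF P Y x)
  -- The initial entropy of `Y` is at most that of smoothed `Y`, hence of smoothed `Z`. This bound
  -- does not depend on `t`, so it survives `t → 0` and also yields integrability for `Z`.
  · have hH : ∀ t, 0 < t → ∫ x, negMulLog (realPDF P Y x) ≤ heatEntropy (P.map Z) t := fun t ht =>
      (integral_negMulLog_le_heatEntropy measurable_realPDF realPDF_nonneg integrable_realPDF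
        (map_eq_withDensity_realPDF hY) (integrable_sq_map hY2) hi ht).trans
      (heatEntropy_le_of_fisher_le (integrable_sq_map hY2) (integrable_sq_map hZ2) h ht)
    obtain ⟨hj, hle⟩ := le_integral_negMulLog measurable_realPDF realPDF_nonneg integrable_realPDF
      (map_eq_withDensity_realPDF hZ) (integrable_sq_map hZ2) hH
    rw [entropy_eq_integral hY hi, entropy_eq_integral hZ hj]
    exact_mod_cast hle
  · rw [entropy_eq_bot hY hY2 hi]
    exact bot_le

end Density

/-! ### Laws and densities of standardized sums. -/

section StandardizedSum

variable {X : ℕ → Ω → ℝ}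

lemma memLp_standardizedSum (hident : ∀ i, IdentDistrib (X i) (X 0) P P) (hvar : MemLp (X 0) 2 P)
    (n : ℕ) : MemLp (standardizedSum X n) 2 P := by
  have : MemLp (fun ω => ∑ i ∈ Finset.range n, X i ω) 2 P :=
    memLp_finsetSum _ fun i _ => (hident i).memLp_iff.2 hvar
  unfold standardizedSum
  simpa only [div_eq_mul_inv] using this.mul_const (√(n : ℝ))⁻¹

variable [IsProbabilityMeasure P]

lemma map_sum_eq_convPow (hindep : iIndepFun X P) (hident : ∀ i, IdentDistrib (X i) (X 0) P P)
    (n : ℕ) : P.map (fun ω => ∑ i ∈ Finset.range n, X i ω) = convPow (P.map (X 0)) n := by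
  have hm : ∀ i, AEMeasurable (X i) P := fun i => (hident i).aemeasurable_fst
  have := Measure.isProbabilityMeasure_map (hm 0)
  induction n with
  | zero => simp [convPow]
  | succ n ih =>
    have hi : IndepFun (∑ i ∈ Finset.range n, X i) (X n) P :=
      hindep.indepFun_finsetSum_of_notMem₀ hm Finset.notMem_range_self
    have hsm : AEMeasurable (∑ i ∈ Finset.range n, X i) P :=
      Finset.aemeasurable_sum _ fun i _ => hm i
    have e : (fun ω => ∑ i ∈ Finset.range (n + 1), X i ω) = (∑ i ∈ Finset.range n, X i) + X n := by
      ext ω; simp [Finset.sum_range_succ]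
    have e' : (∑ i ∈ Finset.range n, X i) = fun ω => ∑ i ∈ Finset.range n, X i ω := by
      ext ω; simp
    rw [e, hi.map_add_eq_map_conv_map₀ hsm (hm n), (hident n).map_eq, e', ih, convPow]

lemma map_standardizedSum (hindep : iIndepFun X P) (hident : ∀ i, IdentDistrib (X i) (X 0) P P)
    (n : ℕ) : P.map (standardizedSum X n) = standardizedLaw (P.map (X 0)) n := by
  have hsm : AEMeasurable (fun ω => ∑ i ∈ Finset.range n, X i ω) P :=
    Finset.aemeasurable_fun_sum _ fun i _ => (hident i).aemeasurable_fst
  rw [standardizedLaw, ← map_sum_eq_convPow hindep hident,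
    AEMeasurable.map_map_of_aemeasurable (by fun_prop) hsm]
  rfl

lemma hasPDF_standardizedSum (hindep : iIndepFun X P)
    (hident : ∀ i, IdentDistrib (X i) (X 0) P P) (hdensity : HasPDF (X 0) P volume)
    (hvar : MemLp (X 0) 2 P) {n : ℕ} (hn : 1 ≤ n) : HasPDF (standardizedSum X n) P volume := by
  rw [Real.hasPDF_iff_of_aemeasurable (memLp_standardizedSum hident hvar n).1.aemeasurable,
    map_standardizedSum hindep hident]
  obtain ⟨k, rfl⟩ : ∃ k, n = k + 1 := ⟨n - 1, by omega⟩
  have := isProbabilityMeasure_map hdensity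
  -- One absolutely continuous summand suffices; this needs a nonempty sum, as `convPow` starts from
  -- a Dirac mass.
  have hac : convPow (P.map (X 0)) (k + 1) ≪ volume :=
    Measure.conv_absolutelyContinuous hdensity.absolutelyContinuous
  have hc : (√((k + 1 : ℕ) : ℝ))⁻¹ ≠ 0 := by positivity
  refine (hac.map (f := (· / √((k + 1 : ℕ) : ℝ))) (by fun_prop)).trans ?_
  refine Measure.AbsolutelyContinuous.mk fun s hs h => ?_
  rw [Measure.map_apply (by fun_prop) hs]
  simp only [div_eq_mul_inv]
  rw [Real.volume_preimage_mul_right hc, h, mul_zero]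

end StandardizedSum

end EntropyMonotonicity

theorem theorem2 {Ω : Type*} [MeasurableSpace Ω] (P : Measure Ω) [IsProbabilityMeasure P]
    (X : ℕ → Ω → ℝ)
    (hindep : iIndepFun X P)
    (hident : ∀ i, IdentDistrib (X i) (X 0) P P)
    (hdensity : HasPDF (X 0) P volume)
    (hvar : MemLp (X 0) 2 P)
    (m n : ℕ) (hm : 1 ≤ m) (hmn : m ≤ n) :
    EntropyMonotonicity.HasEntropy P (EntropyMonotonicity.standardizedSum X m) ∧
    EntropyMonotonicity.HasEntropy P (EntropyMonotonicity.standardizedSum X n) ∧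
    EntropyMonotonicity.entropy P (EntropyMonotonicity.standardizedSum X m) ≤
      EntropyMonotonicity.entropy P (EntropyMonotonicity.standardizedSum X n) := by
  have := EntropyMonotonicity.isProbabilityMeasure_map hdensity
  have hpdf := fun {k} => EntropyMonotonicity.hasPDF_standardizedSum (n := k) hindep hident hdensity
    hvar
  have hmem := EntropyMonotonicity.memLp_standardizedSum hident hvar
  refine ⟨EntropyMonotonicity.hasEntropy_of_memLp (hpdf hm) (hmem m),
    EntropyMonotonicity.hasEntropy_of_memLp (hpdf (hm.trans hmn)) (hmem n),
    EntropyMonotonicity.entropy_le_of_fisher_le (hpdf hm) (hmem m) (hpdf (hm.trans hmn)) (hmem n)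
      fun t ht => ?_⟩
  rw [EntropyMonotonicity.map_standardizedSum hindep hident,
    EntropyMonotonicity.map_standardizedSum hindep hident]
  exact EntropyMonotonicity.fisher_standardizedLaw_anti ht hm hmn
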